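/- **Conventions.** Let $N$ be fixed; all skew Schur functions are in the variables $x_1,\dots,x_N$: $s_{\lambda/\mu}=\sum_T\prod_{c}x_{T(c)}$, the sum over all semistandard tableaux $T$ of skew shape $\lambda/\mu$ with entries in $\{1,\dots,N\}$. Let $\lambda/\mu$ and $\sigma/\tau$ be skew shapes ($\mu\subseteq\lambda$, $\tau\subseteq\sigma$) and let $t$ be an integer. Colour white the *starting points* $(\mu_i-i,1)$ and *ending points* $(\lambda_i-i,N)$, $1\le i\le\ell(\lambda)$, and colour black the starting points $(\tau_i-i+t,1)$ and ending points $(\sigma_i-i+t,N)$, $1\le i\le\ell(\sigma)$ (starting and ending points are always regarded as distinct). A point having exactly one of the two colours is called *coloured*; points having both colours are left unchanged throughout. Order the coloured points circularly: first the ending points from right to left, then the starting points from left to right. White ending points and black starting points are *oriented inward*; black ending points and white starting points are *oriented outward*. Conversely, any set of coloured points, declared to be the inward ones, determines a colouring of the coloured points by the same rule. An *admissible matching* is a perfect matching of the coloured points, each edge of which joins an inward and an outward point, and which is non-crossing, i.e. no two edges cross when drawn as chords of the circle. A colouring with equally many white starting and white ending points, and equally many black starting and black ending points, corresponds to a pair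 $(\lambda'/\mu',\sigma'/\tau')$ of shapes: if the white points are $b_1>\dots>b_r$ (ending) and $a_1>\dots>a_r$ (starting), then $\lambda'_i=b_i+i-t'$ and $\mu'_i=a_i+i-t'$ for a suitable shift $t'$ making all parts nonnegative (the shift does not affect $s_{\lambda'/\mu'}$), with the convention $s_{\lambda'/\mu'}=0$ if $b_i<a_i$ for some $i$; likewise $\sigma'/\tau'$ from the black points. **Theorem.** Assume that in the circular order the orientations of the coloured points alternate. Let $S$ be any subset of the inward oriented points. Let $Q$ be the set of all orientations of the coloured points which can be obtained by choosing some admissible matching and reversing the orientations of both endpoints of each of its edges incident with a point of $S$ (each resulting orientation being counted once, however many matchings produce it). Then $$s_{\lambda/\mu}\cdot s_{\sigma/\tau}=\sum_{Q}s_{\lambda'/\mu'}\cdot s_{\sigma'/\tau'},$$ where $(\lambda'/\mu',\sigma'/\tau')$ is the pair of shapes corresponding to the respective orientation in $Q$. -/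

import Mathlib

namespace BicolouredPaths

open scoped Classical in
/-- The semistandard fillings of the skew diagram `lam / mu`: one entry of the `N`-element chain
`Fin N` (standing for `{1, …, N}`) in each cell, weakly increasing along rows and strictly
increasing down columns. Cells are pairs `(row, column)`, both counted from `0`. -/
noncomputable def skewTableaux (N : ℕ) (lam mu : YoungDiagram) :
    Finset (↥(lam.cells \ mu.cells) → Fin N) :=
  Finset.univ.filter fun T =>
    (∀ c d : ↥(lam.cells \ mu.cells), c.1.1 = d.1.1 → c.1.2 < d.1.2 → T c ≤ T d) ∧
    (∀ c d : ↥(lam.cells \ mu.cells), c.1.2 = d.1.2 → c.1.1 < d.1.1 → T c < T d)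

/-- The skew Schur function `s_{lam/mu}(x_1, …, x_N)`, for `mu ≤ lam`: the sum over all
semistandard fillings of the product of the variables indexed by the entries. -/
noncomputable def skewSchur (N : ℕ) (lam mu : YoungDiagram) : MvPolynomial (Fin N) ℤ :=
  ∑ T ∈ skewTableaux N lam mu, ∏ c, MvPolynomial.X (T c)

/-- Starting points (on level `1`) and ending points (on level `N`) of lattice paths, recorded by
their horizontal coordinate. The lexicographic order on the sum, with the order on the first
summand reversed, lists the ending points from right to left and then the starting points from left
to right; this is the circular order of the points, cut open before the rightmost ending point. -/
abbrev BPoint : Type := ℤᵒᵈ ⊕ₗ ℤ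

/-- The ending point `(x, N)`. -/
def endPt (x : ℤ) : BPoint := Sum.inlₗ (OrderDual.toDual x)

/-- The starting point `(x, 1)`. -/
def startPt (x : ℤ) : BPoint := Sum.inrₗ x

/-- `p` is an ending point, that is, lies on the upper half of the circle. -/
def IsEnd (p : BPoint) : Prop := (ofLex p).isLeft = true

instance : DecidablePred IsEnd := fun p => inferInstanceAs (Decidable ((ofLex p).isLeft = true))

/-- The horizontal coordinate of a point. -/
def xCoord (p : BPoint) : ℤ := Sum.elim OrderDual.ofDual id (ofLex p)

/-- Horizontal coordinates of the ending points in `F`. -/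
def endXs (F : Finset BPoint) : Finset ℤ := (F.filter IsEnd).image xCoord

/-- Horizontal coordinates of the starting points in `F`. -/
def startXs (F : Finset BPoint) : Finset ℤ := (F.filter fun p => ¬ IsEnd p).image xCoord

/-- The starting and ending points of the skew shape `lam / mu` with shift `t`: for each of the
`ℓ(lam)` rows of `lam` (numbered `i + 1` with `i < ℓ(lam)`), the starting point
`(mu_{i+1} - (i+1) + t, 1)` and the ending point `(lam_{i+1} - (i+1) + t, N)`. -/
def shapePoints (lam mu : YoungDiagram) (t : ℤ) : Finset BPoint :=
  (Finset.range (lam.colLen 0)).image (fun i => endPt ((lam.rowLen i : ℤ) - (i + 1) + t)) ∪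
  (Finset.range (lam.colLen 0)).image (fun i => startPt ((mu.rowLen i : ℤ) - (i + 1) + t))

/-- The `(i+1)`-st largest element of a set of `r` integers. -/
def nthLargest {r : ℕ} (E : Finset ℤ) (h : E.card = r) (i : Fin r) : ℤ :=
  E.orderEmbOfFin h i.rev

theorem pointRows_antitone {r : ℕ} (E : Finset ℤ) (h : E.card = r) (t : ℤ) :
    Antitone fun i : Fin r => (nthLargest E h i + ((i : ℕ) + 1) - t).toNat := by
  have key : ∀ (k : ℕ) (i j : Fin r), (j : ℕ) = i + k →
      nthLargest E h j + (j : ℕ) ≤ nthLargest E h i + (i : ℕ) := by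
    intro k
    induction k with
    | zero =>
      intro i j hij
      have : i = j := by ext; omega
      subst this; exact le_rfl
    | succ k ih =>
      intro i j hij
      have hm : (i : ℕ) + k < r := by have := j.2; omega
      have h1 := ih i ⟨i + k, hm⟩ rfl
      have h2 : nthLargest E h j < nthLargest E h ⟨i + k, hm⟩ := by
        apply (E.orderEmbOfFin h).strictMono
        apply Fin.rev_lt_rev.mpr
        rw [Fin.lt_def]; simp only; omega
      simp only at h1
      push_cast at h1
      rw [hij]; push_cast
      omega
  intro i j hij
  have := key (j - i) i j (by have := Fin.le_def.mp hij; omega)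
  apply Int.toNat_le_toNat
  omega

/-- The partition with `r` rows (some possibly empty) whose `i`-th point `lam_i - i + t` is the
`i`-th largest element of `E`. -/
def pointPartition {r : ℕ} (E : Finset ℤ) (h : E.card = r) (t : ℤ) : YoungDiagram :=
  YoungDiagram.ofRowLens
    (List.ofFn fun i : Fin r => (nthLargest E h i + ((i : ℕ) + 1) - t).toNat)
    (pointRows_antitone E h t).sortedGE_ofFn

open scoped Classical in
/-- The skew Schur function belonging to a set `F` of starting and ending points. It is `0` if some
ending point lies to the left of the corresponding starting point (then there are no
nonintersecting paths); otherwise it is the skew Schur function of the shape that the points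
determine. The shift is normalized so that the last row of the inner partition is `0`; any other
shift with nonnegative rows translates the skew diagram horizontally. -/
noncomputable def pointsSchur (N : ℕ) (F : Finset BPoint) : MvPolynomial (Fin N) ℤ :=
  if h : (endXs F).card = (startXs F).card then
    if ∀ i, nthLargest (startXs F) rfl i ≤ nthLargest (endXs F) h i then
      skewSchur N
        (pointPartition (endXs F) h ((startXs F).min.untopD 0 + (startXs F).card))
        (pointPartition (startXs F) rfl ((startXs F).min.untopD 0 + (startXs F).card))
    else 0
  else 0

/-- A placement of white and black starting and ending points. -/
structure Placement where
  /-- points coloured white -/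
  white : Finset BPoint
  /-- points coloured black -/
  black : Finset BPoint

namespace Placement

/-- White points from `lam / mu` with shift `0`, black points from `sig / tau` with shift `t`. -/
def ofShapes (lam mu sig tau : YoungDiagram) (t : ℤ) : Placement where
  white := shapePoints lam mu 0
  black := shapePoints sig tau t

/-- The coloured points: those with exactly one of the two colours. -/
def coloured (K : Placement) : Finset BPoint := symmDiff K.white K.black

/-- The coloured points oriented towards the centre of the circle. White paths are oriented
downwards and black paths upwards, so these are the white ending and the black starting points. -/
def inward (K : Placement) : Finset BPoint :=
  K.coloured.filter fun p => (p ∈ K.white ↔ IsEnd p)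

/-- The placement with the same points and the same doubly coloured points in which exactly the
coloured points in `I` are oriented towards the centre. -/
def reorient (K : Placement) (I : Finset BPoint) : Placement where
  white := (K.white ∩ K.black) ∪ K.coloured.filter fun p => (p ∈ I ↔ IsEnd p)
  black := (K.white ∩ K.black) ∪ K.coloured.filter fun p => ¬ (p ∈ I ↔ IsEnd p)

/-- The orientations alternate: of two consecutive coloured points exactly one is oriented towards
the centre. (The last and the first point then also have different orientations, because
the number of coloured points is even.) -/
def IsAlternating (K : Placement) : Prop :=
  ∀ p ∈ K.coloured, ∀ q ∈ K.coloured, p < q → (∀ z ∈ K.coloured, ¬ (p < z ∧ z < q)) →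
    (p ∈ K.inward ↔ q ∉ K.inward)

/-- An admissible matching, given by the map sending each coloured point to its partner: a perfect
matching of the coloured points, each edge joining points of different orientation, and no two
edges crossing. -/
structure IsAdmissibleMatching (K : Placement) (m : BPoint → BPoint) : Prop where
  mem : ∀ p ∈ K.coloured, m p ∈ K.coloured
  invol : ∀ p ∈ K.coloured, m (m p) = p
  orient : ∀ p ∈ K.coloured, (p ∈ K.inward ↔ m p ∉ K.inward)
  noncrossing : ∀ p ∈ K.coloured, ∀ q ∈ K.coloured, ¬ (p < q ∧ q < m p ∧ m p < m q)

open scoped Classical in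
/-- The set of orientations (each given by its set of inward oriented points) obtained by reversing,
in some admissible matching, all edges incident with points of `S`. -/
noncomputable def reorientations (K : Placement) (S : Finset BPoint) : Finset (Finset BPoint) :=
  K.coloured.powerset.filter fun I =>
    ∃ m, K.IsAdmissibleMatching m ∧ I = symmDiff K.inward (S ∪ S.image m)

end Placement

end BicolouredPaths

/-! The proof is linear algebra on functions of orientations. Let `P` be the set of coloured points,
and let an orientation be the set `I ⊆ P` of its inward points. The product of the two skew Schur
functions belonging to `I` defines a function `F` of `I` (`orientationAmplitude`), and the theorem
compares its value at the given orientation with a sum of its other values.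

A skew Schur function is read as a generating function of particles on the integers that hop one
step to the right at a time: adding a cell of content `c` with entry `k` moves a particle with
weight `x_k` (`amplitude_rowPoints`). Free fermions satisfy a bilinear relation: transferring a
particle between two systems, summed over all positions with signs, commutes with the evolution
(`sum_amplitude_mul_amplitude`). For `F` this relation says that the signed raising operator kills
it (`raising_orientationAmplitude`). Conservation of particles shows that `F` lives on sets with `2
* |I| = |P|`.

Functions of subsets of `P` form a tensor power of the two-dimensional representation of `sl₂`, up
to signs. A function of weight zero killed by the raising operator is an invariant, and the
invariants are spanned by noncrossing perfect matchings (`mem_matchSpan`): a matching gives the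
indicator of the sets containing exactly one end of each edge.

It remains to check the identity for one matching `m` (`sum_matchFun_reorientations`). Every edge of
`m` spans an even number of points, so in an alternating orientation it joins an inward and an
outward point. Hence the given orientation is compatible with `m`. Among the orientations in `Q`
exactly one is compatible with `m`, the one produced by `m` itself. Both sides are therefore `1`,
and linearity finishes the proof. -/

namespace BicolouredPaths

/-! ### The signed raising operator on functions of subsets, and its injectivity. -/

section Raising

variable {α R : Type*} [LinearOrder α] [CommRing R]

/-- The signed raising operator on functions of subsets of `P`. -/
def raising (P : Finset α) (F : Finset α → R) (I : Finset α) : R :=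
  ∑ p ∈ P \ I, (-1) ^ (P.filter (· < p)).card * F (insert p I)

theorem raising_congr {P : Finset α} {F G : Finset α → R} (h : ∀ J ⊆ P, F J = G J)
    {I : Finset α} (hI : I ⊆ P) : raising P F I = raising P G I := by
  refine Finset.sum_congr rfl fun p hp => ?_
  rw [h _ (Finset.insert_subset (Finset.mem_sdiff.mp hp).1 hI)]

theorem raising_add (P : Finset α) (F G : Finset α → R) (I : Finset α) :
    raising P (F + G) I = raising P F I + raising P G I := by
  simp only [raising, Pi.add_apply, mul_add, Finset.sum_add_distrib]

theorem raising_smul (P : Finset α) (c : R) (F : Finset α → R) (I : Finset α) :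
    raising P (c • F) I = c * raising P F I := by
  simp only [raising, Pi.smul_apply, smul_eq_mul, Finset.mul_sum]
  exact Finset.sum_congr rfl fun p _ => by ring

theorem raising_zero (P : Finset α) (I : Finset α) : raising P (0 : Finset α → R) I = 0 := by
  simp [raising]

theorem filter_insert_max {a : α} {P : Finset α} {p : α} (hp : p ≤ a) :
    (insert a P).filter (· < p) = P.filter (· < p) := by
  rw [Finset.filter_insert, if_neg (not_lt.mpr hp)]

theorem filter_lt_max {a : α} {P : Finset α} (ha : ∀ x ∈ P, x < a) :
    P.filter (· < a) = P := Finset.filter_true_of_mem ha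

theorem raising_insert_max_mem {a : α} {P : Finset α} (ha : ∀ x ∈ P, x < a)
    (F : Finset α → R) {I : Finset α} :
    raising (insert a P) F (insert a I) = raising P (fun J => F (insert a J)) I := by
  have haP : a ∉ P := fun h => lt_irrefl _ (ha a h)
  have h : insert a P \ insert a I = P \ I := by
    ext x
    simp only [Finset.mem_sdiff, Finset.mem_insert, not_or]
    constructor
    · rintro ⟨h1 | h1, h2, h3⟩
      · exact absurd h1 h2
      · exact ⟨h1, h3⟩
    · rintro ⟨h1, h2⟩
      exact ⟨Or.inr h1, fun e => haP (e ▸ h1), h2⟩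
  unfold raising
  rw [h]
  refine Finset.sum_congr rfl fun p hp => ?_
  rw [filter_insert_max (ha p (Finset.mem_sdiff.mp hp).1).le, Finset.insert_comm]

theorem raising_insert_max_notMem {a : α} {P : Finset α} (ha : ∀ x ∈ P, x < a)
    (F : Finset α → R) {I : Finset α} (hI : I ⊆ P) :
    raising (insert a P) F I = raising P F I + (-1) ^ P.card * F (insert a I) := by
  have haP : a ∉ P := fun h => lt_irrefl _ (ha a h)
  unfold raising
  rw [Finset.insert_sdiff_of_notMem _ (fun h => haP (hI h)),
    Finset.sum_insert (fun h => haP (Finset.mem_sdiff.mp h).1), add_comm,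
    filter_insert_max le_rfl, filter_lt_max ha]
  congr 1
  refine Finset.sum_congr rfl fun p hp => ?_
  rw [filter_insert_max (ha p (Finset.mem_sdiff.mp hp).1).le]

theorem iterate_raising_congr {P : Finset α} {F G : Finset α → R} (h : ∀ J ⊆ P, F J = G J)
    (j : ℕ) : ∀ I ⊆ P, (raising P)^[j] F I = (raising P)^[j] G I := by
  induction j with
  | zero => exact h
  | succ j ih =>
    intro I hI
    rw [Function.iterate_succ_apply', Function.iterate_succ_apply']
    exact raising_congr ih hI

theorem iterate_raising_zero (P : Finset α) (j : ℕ) :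
    (raising P)^[j] (0 : Finset α → R) = 0 := by
  induction j with
  | zero => rfl
  | succ j ih =>
    rw [Function.iterate_succ_apply', ih]
    exact funext (raising_zero P)

theorem iterate_raising_insert_max_mem {a : α} {P : Finset α} (ha : ∀ x ∈ P, x < a)
    (F : Finset α → R) (j : ℕ) (I : Finset α) :
    (raising (insert a P))^[j] F (insert a I) =
      (raising P)^[j] (fun J => F (insert a J)) I := by
  induction j generalizing I with
  | zero => rfl
  | succ j ih =>
    rw [Function.iterate_succ_apply', Function.iterate_succ_apply', raising_insert_max_mem ha]
    congr 1
    exact funext ih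

/-- On sets avoiding `a` the operator is the one of `P` plus the signed insertion of `a`. The two
commute, as `a` is largest and does not affect other signs, and the insertion squares to zero. So
only the linear term of the binomial expansion survives. -/
theorem iterate_raising_insert_max_notMem {a : α} {P : Finset α} (ha : ∀ x ∈ P, x < a)
    (F : Finset α → R) (j : ℕ) : ∀ I ⊆ P,
    (raising (insert a P))^[j + 1] F I = (raising P)^[j + 1] F I +
      ((j + 1 : ℕ) : R) * (-1) ^ P.card * (raising P)^[j] (fun J => F (insert a J)) I := by
  induction j with
  | zero =>
    intro I hI
    simp [raising_insert_max_notMem ha F hI]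
  | succ j ih =>
    intro I hI
    rw [Function.iterate_succ_apply', raising_insert_max_notMem ha _ hI,
      iterate_raising_insert_max_mem ha]
    have : raising P ((raising (insert a P))^[j + 1] F) I =
        raising P ((raising P)^[j + 1] F + (((j + 1 : ℕ) : R) * (-1) ^ P.card) •
          (raising P)^[j] (fun J => F (insert a J))) I :=
      raising_congr (fun J hJ => by rw [ih J hJ]; rfl) hI
    rw [this, raising_add, raising_smul, ← Function.iterate_succ_apply' (raising P),
      ← Function.iterate_succ_apply' (raising P)]
    push_cast
    ring

/-- Powers of the raising operator are injective below the middle weight. -/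
theorem eq_zero_of_iterate_raising [IsDomain R] [CharZero R] (P : Finset α) :
    ∀ (k j : ℕ) (F : Finset α → R), j ≤ k →
      (∀ I ⊆ P, F I ≠ 0 → 2 * I.card = P.card + k) →
      (∀ I ⊆ P, (raising P)^[j] F I = 0) → ∀ I ⊆ P, F I = 0 := by
  induction P using Finset.induction_on_max with
  | empty =>
    intro k j F hjk hF h I hI
    by_contra hne
    have h0 := hF I hI hne
    rw [Finset.subset_empty.mp hI] at h0
    simp at h0
    obtain rfl : j = 0 := by omega
    exact hne (h I hI)
  | insert a P ha ih =>
    intro k j F hjk hF h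
    have haP : a ∉ P := fun h => lt_irrefl _ (ha a h)
    have hsub : ∀ {I}, I ⊆ P → I ⊆ insert a P := fun h => h.trans (Finset.subset_insert _ _)
    have hins : ∀ {I}, I ⊆ P → insert a I ⊆ insert a P := fun h => Finset.insert_subset_insert _ h
    have hcard : (insert a P).card = P.card + 1 := Finset.card_insert_of_notMem haP
    rcases j with _ | j
    · exact h
    have hin : ∀ I ⊆ P, (raising P)^[j + 1] (fun J => F (insert a J)) I = 0 := fun I hI => by
      rw [← iterate_raising_insert_max_mem ha]; exact h _ (hins hI)
    -- On sets avoiding `a` the weight relative to `P` is `k + 1`, so exponent `j + 2` is still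
    -- allowed. One extra application of the operator helps because the term coming from sets
    -- containing `a` then vanishes by `hin`.
    have hout : ∀ I ⊆ P, F I = 0 := by
      refine ih (k + 1) (j + 2) F (by omega) (fun I hI hne => ?_) fun I hI => ?_
      · have := hF I (hsub hI) hne; omega
      · have h1 := iterate_raising_insert_max_notMem ha F (j + 1) I hI
        rw [hin I hI, mul_zero, add_zero] at h1
        rw [← h1, Function.iterate_succ_apply',
          raising_congr (G := 0) (fun J hJ => h J hJ) (hsub hI), raising_zero]
    -- Here the weight drops to `k - 1`, and `hin` alone has too large an exponent. With `hout`
    -- known, the expansion leaves only `(j + 1)` times a sign times the `j`-th power, and `j + 1`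
    -- cancels in characteristic zero.
    have hin' : ∀ I ⊆ P, F (insert a I) = 0 := by
      refine ih (k - 1) j (fun J => F (insert a J)) (by omega) (fun I hI hne => ?_) fun I hI => ?_
      · have := hF _ (hins hI) hne
        rw [Finset.card_insert_of_notMem (fun h => haP (hI h))] at this; omega
      · have h1 := iterate_raising_insert_max_notMem ha F j I hI
        rw [h I (hsub hI), iterate_raising_congr (G := 0) hout (j + 1) I hI,
          iterate_raising_zero, Pi.zero_apply, zero_add] at h1
        rcases mul_eq_zero.mp h1.symm with h2 | h2
        · rcases mul_eq_zero.mp h2 with h3 | h3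
          · exact absurd h3 (Nat.cast_ne_zero.mpr (Nat.succ_ne_zero j))
          · exact absurd h3 (pow_ne_zero _ (neg_ne_zero.mpr one_ne_zero))
        · exact h2
    intro I hI
    by_cases haI : a ∈ I
    · rw [← Finset.insert_erase haI]
      exact hin' _ (Finset.subset_insert_iff.mp hI)
    · exact hout I ((Finset.subset_insert_iff_of_notMem haI).mp hI)

end Raising

/-! ### Noncrossing partial matchings and the functions killed by the raising operator. -/

section Matchings

variable {α R : Type*} [LinearOrder α] [CommRing R]

/-- `m` is a noncrossing partial matching of `P`: an involution of `P` whose edges do not cross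
and do not cover any fixed point. -/
structure IsPartialMatching (P : Finset α) (m : α → α) : Prop where
  mem : ∀ p ∈ P, m p ∈ P
  invol : ∀ p ∈ P, m (m p) = p
  nested : ∀ p ∈ P, ∀ q ∈ P, p < q → q < m p → p < m q ∧ m q < m p ∧ m q ≠ q

/-- Every edge of `m` has exactly one end in `I`, and the fixed points of `m` are not in `I`. -/
structure Compatible (P : Finset α) (m : α → α) (I : Finset α) : Prop where
  subset : I ⊆ P
  notMem : ∀ p ∈ P, p ∈ I → m p ∉ I
  mem : ∀ p ∈ P, m p ≠ p → p ∉ I → m p ∈ I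

open scoped Classical in
/-- The indicator function of the sets compatible with a matching. -/
noncomputable def matchFun (R : Type*) [CommRing R] (P : Finset α) (m : α → α) (I : Finset α) : R :=
  if Compatible P m I then 1 else 0

/-- The fixed points of a partial matching. -/
def defects (P : Finset α) (m : α → α) : Finset α := P.filter fun p => m p = p

theorem even_card_of_involution {α : Type*} {s : Finset α} {m : α → α} (hmem : ∀ p ∈ s, m p ∈ s)
    (hinv : ∀ p ∈ s, m (m p) = p) (hne : ∀ p ∈ s, m p ≠ p) : Even s.card := by
  have h : ∑ _x ∈ s, (1 : ZMod 2) = 0 :=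
    Finset.sum_involution (fun p _ => m p) (fun _ _ => by decide) (fun p hp _ => hne p hp)
      (fun p hp => hmem p hp) (fun p hp => hinv p hp)
  rw [Finset.sum_const, nsmul_eq_mul, mul_one] at h
  exact (ZMod.natCast_eq_zero_iff_even).mp h

/-- The points strictly below an edge are matched among themselves. -/
theorem IsPartialMatching.even_card_between {P : Finset α} {m : α → α}
    (hm : IsPartialMatching P m) {p : α} (hp : p ∈ P) :
    Even (P.filter fun q => p < q ∧ q < m p).card := by
  refine even_card_of_involution (m := m) ?_ ?_ ?_ <;> intro q hq <;>
    simp only [Finset.mem_filter] at hq ⊢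
  · have := hm.nested p hp q hq.1 hq.2.1 hq.2.2
    exact ⟨hm.mem q hq.1, this.1, this.2.1⟩
  · exact hm.invol q hq.1
  · exact (hm.nested p hp q hq.1 hq.2.1 hq.2.2).2.2

theorem card_filter_lt {P : Finset α} {m : α → α} {p : α} (hp : p ∈ P) (hlt : p < m p) :
    (P.filter (· < m p)).card =
      (P.filter (· < p)).card + (P.filter fun q => p < q ∧ q < m p).card + 1 := by
  have h : P.filter (· < m p) =
      insert p (P.filter (· < p) ∪ P.filter fun q => p < q ∧ q < m p) := by
    ext q
    simp only [Finset.mem_filter, Finset.mem_insert, Finset.mem_union]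
    constructor
    · rintro ⟨h1, h2⟩
      rcases lt_trichotomy q p with h | h | h
      · exact Or.inr (Or.inl ⟨h1, h⟩)
      · exact Or.inl h
      · exact Or.inr (Or.inr ⟨h1, h, h2⟩)
    · rintro (rfl | ⟨h1, h2⟩ | ⟨h1, h2, h3⟩)
      · exact ⟨hp, hlt⟩
      · exact ⟨h1, h2.trans hlt⟩
      · exact ⟨h1, h3⟩
  rw [h, Finset.card_insert_of_notMem, Finset.card_union_of_disjoint]
  · rw [Finset.disjoint_filter]
    exact fun q _ h1 h2 => lt_asymm h1 h2.1
  · simp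

theorem IsPartialMatching.sign_apply {P : Finset α} {m : α → α} (hm : IsPartialMatching P m)
    {p : α} (hp : p ∈ P) (hne : m p ≠ p) :
    ((-1) ^ (P.filter (· < m p)).card : R) = -(-1) ^ (P.filter (· < p)).card := by
  have key : ∀ p ∈ P, p < m p →
      ((-1) ^ (P.filter (· < m p)).card : R) = -(-1) ^ (P.filter (· < p)).card := by
    intro p hp hlt
    rw [card_filter_lt hp hlt, pow_succ, pow_add, (hm.even_card_between hp).neg_one_pow]
    ring
  rcases lt_or_gt_of_ne hne with h | h
  · have := key (m p) (hm.mem p hp) (by rwa [hm.invol p hp])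
    rw [hm.invol p hp] at this
    rw [this, neg_neg]
  · exact key p hp h

theorem IsPartialMatching.compatible_swap {P : Finset α} {m : α → α}
    (hm : IsPartialMatching P m) {I : Finset α} {p : α} (hp : p ∈ P) (hpI : p ∉ I)
    (h : Compatible P m (insert p I)) : Compatible P m (insert (m p) I) := by
  have hmp := h.notMem p hp (Finset.mem_insert_self _ _)
  simp only [Finset.mem_insert, not_or] at hmp
  have hinj : ∀ q ∈ P, m q = m p → q = p := fun q hq e => by
    rw [← hm.invol q hq, e, hm.invol p hp]
  refine ⟨?_, ?_, ?_⟩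
  · exact Finset.insert_subset (hm.mem p hp) ((Finset.subset_insert p I).trans h.subset)
  · intro q hq hqI hmq
    rw [Finset.mem_insert] at hqI hmq
    rcases hqI with rfl | hqI
    · rw [hm.invol p hp] at hmq
      rcases hmq with e | e
      · exact hmp.1 e.symm
      · exact hpI e
    · rcases hmq with e | e
      · exact hpI (hinj q hq e ▸ hqI)
      · exact h.notMem q hq (Finset.mem_insert_of_mem hqI) (Finset.mem_insert_of_mem e)
  · intro q hq hne hqI
    rw [Finset.mem_insert, not_or] at hqI
    by_cases e : q = p
    · rw [e]; exact Finset.mem_insert_self _ _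
    · have := h.mem q hq hne (by simp [e, hqI.2])
      rw [Finset.mem_insert] at this
      rcases this with e1 | e1
      · exact absurd (by rw [← e1, hm.invol q hq]) hqI.1
      · exact Finset.mem_insert_of_mem e1

/-- The terms for `p` and `m p` cancel: inserting either end of an edge gives compatible sets
simultaneously, and the signs differ because an even number of points lies between the ends.
Incompatible insertions contribute zero and are left fixed by the involution. -/
theorem raising_matchFun {P : Finset α} {m : α → α} (hm : IsPartialMatching P m)
    (I : Finset α) : raising P (matchFun R P m) I = 0 := by
  classical
  refine Finset.sum_involution
    (fun p _ => if Compatible P m (insert p I) then m p else p) ?_ ?_ ?_ ?_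
  · intro p hp
    rw [Finset.mem_sdiff] at hp
    by_cases h : Compatible P m (insert p I)
    · have hmp := h.notMem p hp.1 (Finset.mem_insert_self _ _)
      have hne : m p ≠ p := fun e => hmp (by rw [e]; exact Finset.mem_insert_self _ _)
      simp only [matchFun, if_pos h, if_pos (hm.compatible_swap hp.1 hp.2 h),
        hm.sign_apply (R := R) hp.1 hne]
      ring
    · simp [matchFun, h]
  · intro p hp hne
    rw [Finset.mem_sdiff] at hp
    by_cases h : Compatible P m (insert p I)
    · have hmp := h.notMem p hp.1 (Finset.mem_insert_self _ _)
      rw [if_pos h]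
      exact fun e => hmp (by rw [e]; exact Finset.mem_insert_self _ _)
    · simp [matchFun, h] at hne
  · intro p hp
    by_cases h : Compatible P m (insert p I)
    · rw [if_pos h]
      rw [Finset.mem_sdiff] at hp ⊢
      have hmp := h.notMem p hp.1 (Finset.mem_insert_self _ _)
      exact ⟨hm.mem p hp.1, fun e => hmp (Finset.mem_insert_of_mem e)⟩
    · rwa [if_neg h]
  · intro p hp
    rw [Finset.mem_sdiff] at hp
    by_cases h : Compatible P m (insert p I)
    · simp only [if_pos h, if_pos (hm.compatible_swap hp.1 hp.2 h)]
      exact hm.invol p hp.1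
    · simp only [if_neg h]

/-- `P` is the disjoint union of `I`, its mirror image under `m`, and the defects. -/
theorem Compatible.card_eq {P : Finset α} {m : α → α} (hm : IsPartialMatching P m)
    {I : Finset α} (h : Compatible P m I) : P.card = 2 * I.card + (defects P m).card := by
  have hinj : Set.InjOn m I := fun x hx y hy e => by
    rw [← hm.invol x (h.subset hx), e, hm.invol y (h.subset hy)]
  have hP : P = (I ∪ I.image m) ∪ defects P m := by
    ext x
    simp only [defects, Finset.mem_union, Finset.mem_image, Finset.mem_filter]
    constructor
    · intro hx
      by_cases h1 : x ∈ I
      · exact Or.inl (Or.inl h1)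
      by_cases h2 : m x = x
      · exact Or.inr ⟨hx, h2⟩
      · exact Or.inl (Or.inr ⟨m x, h.mem x hx h2 h1, hm.invol x hx⟩)
    · rintro ((h1 | ⟨y, hy, rfl⟩) | h1)
      · exact h.subset h1
      · exact hm.mem y (h.subset hy)
      · exact h1.1
  have hd1 : Disjoint I (I.image m) := by
    rw [Finset.disjoint_left]
    intro x hx hx'
    obtain ⟨y, hy, rfl⟩ := Finset.mem_image.mp hx'
    exact h.notMem y (h.subset hy) hy hx
  have hd2 : Disjoint (I ∪ I.image m) (defects P m) := by
    rw [Finset.disjoint_left]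
    intro x hx hx'
    have hx2 := (Finset.mem_filter.mp hx').2
    have hxI : x ∉ I := fun e => h.notMem x (h.subset e) e (hx2.symm ▸ e)
    rcases Finset.mem_union.mp hx with e | e
    · exact hxI e
    · obtain ⟨y, hy, rfl⟩ := Finset.mem_image.mp e
      rw [hm.invol y (h.subset hy)] at hx2
      exact hxI (hx2 ▸ hy)
  conv_lhs => rw [hP]
  rw [Finset.card_union_of_disjoint hd2, Finset.card_union_of_disjoint hd1,
    Finset.card_image_of_injOn hinj]
  ring

/-- The span of the indicator functions of noncrossing partial matchings with `d` defects. -/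
noncomputable def matchSpan (R : Type*) [CommRing R] (P : Finset α) (d : ℕ) :
    Submodule R (Finset α → R) :=
  Submodule.span R {χ | ∃ m, IsPartialMatching P m ∧ (defects P m).card = d ∧ χ = matchFun R P m}

theorem raising_eq_zero_of_mem_matchSpan {P : Finset α} {d : ℕ} {F : Finset α → R}
    (hF : F ∈ matchSpan R P d) (I : Finset α) : raising P F I = 0 := by
  induction hF using Submodule.span_induction with
  | mem x h => obtain ⟨m, hm, -, rfl⟩ := h; exact raising_matchFun hm I
  | zero => exact raising_zero P I
  | add x y _ _ hx hy => rw [raising_add, hx, hy, add_zero]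
  | smul c x _ hx => rw [raising_smul, hx, mul_zero]

theorem support_of_mem_matchSpan {P : Finset α} {d : ℕ} {F : Finset α → R}
    (hF : F ∈ matchSpan R P d) (I : Finset α) (hI : F I ≠ 0) :
    I ⊆ P ∧ P.card = 2 * I.card + d := by
  contrapose! hI
  induction hF using Submodule.span_induction with
  | mem x h =>
    obtain ⟨m, hm, hd, rfl⟩ := h
    refine if_neg fun hc => hI hc.subset ?_
    rw [hc.card_eq hm, hd]
  | zero => rfl
  | add x y _ _ hx hy => rw [Pi.add_apply, hx, hy, add_zero]
  | smul c x _ hx => rw [Pi.smul_apply, hx, smul_zero]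

theorem IsPartialMatching.push {a : α} {P : Finset α} (ha : ∀ x ∈ P, x < a) {m : α → α}
    (hm : IsPartialMatching P m) : IsPartialMatching (insert a P) (Function.update m a a) := by
  have hne : ∀ x ∈ P, x ≠ a := fun x hx => (ha x hx).ne
  have hu : ∀ x ∈ P, Function.update m a a x = m x := fun x hx =>
    Function.update_of_ne (hne x hx) _ _
  have hua : Function.update m a a a = a := Function.update_self _ _ _
  refine ⟨?_, ?_, ?_⟩
  · intro p hp
    rcases Finset.mem_insert.mp hp with rfl | hp
    · rw [hua]; exact Finset.mem_insert_self _ _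
    · rw [hu p hp]; exact Finset.mem_insert_of_mem (hm.mem p hp)
  · intro p hp
    rcases Finset.mem_insert.mp hp with rfl | hp
    · rw [hua, hua]
    · rw [hu p hp, hu _ (hm.mem p hp), hm.invol p hp]
  · intro p hp q hq h1 h2
    rcases Finset.mem_insert.mp hp with rfl | hp
    · rw [hua] at h2; exact absurd h1 (lt_asymm h2)
    · rw [hu p hp] at h2 ⊢
      rcases Finset.mem_insert.mp hq with hqa | hq
      · exact absurd (hqa ▸ h2) (lt_asymm (ha _ (hm.mem p hp)))
      · rw [hu q hq]
        exact hm.nested p hp q hq h1 h2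

theorem defects_push {a : α} {P : Finset α} (ha : ∀ x ∈ P, x < a) {m : α → α} :
    (defects (insert a P) (Function.update m a a)).card = (defects P m).card + 1 := by
  have haP : a ∉ P := fun h => lt_irrefl _ (ha a h)
  unfold defects
  rw [Finset.filter_insert, if_pos (Function.update_self _ _ _), Finset.card_insert_of_notMem
    (fun h => haP (Finset.mem_filter.mp h).1)]
  congr 2
  refine Finset.filter_congr fun x hx => ?_
  rw [Function.update_of_ne (ha x hx).ne]

theorem matchFun_push {a : α} {P : Finset α} (ha : ∀ x ∈ P, x < a) {m : α → α} (I : Finset α) :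
    matchFun R (insert a P) (Function.update m a a) I = if a ∈ I then 0 else matchFun R P m I := by
  have hu : ∀ x ∈ P, Function.update m a a x = m x := fun x hx =>
    Function.update_of_ne (ha x hx).ne _ _
  have hua : Function.update m a a a = a := Function.update_self _ _ _
  unfold matchFun
  by_cases haI : a ∈ I
  · rw [if_pos haI, if_neg]
    intro h
    exact h.notMem a (Finset.mem_insert_self _ _) haI (by rwa [hua])
  · rw [if_neg haI]
    congr 1
    refine propext ⟨fun h => ⟨?_, ?_, ?_⟩, fun h => ⟨?_, ?_, ?_⟩⟩
    · exact (Finset.subset_insert_iff_of_notMem haI).mp h.subset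
    · intro p hp hpI
      have := h.notMem p (Finset.mem_insert_of_mem hp) hpI
      rwa [hu p hp] at this
    · intro p hp hne hpI
      have := h.mem p (Finset.mem_insert_of_mem hp) (by rwa [hu p hp]) hpI
      rwa [hu p hp] at this
    · exact h.subset.trans (Finset.subset_insert _ _)
    · intro p hp hpI
      rcases Finset.mem_insert.mp hp with rfl | hp
      · exact absurd hpI haI
      · rw [hu p hp]; exact h.notMem p hp hpI
    · intro p hp hne hpI
      rcases Finset.mem_insert.mp hp with rfl | hp
      · exact absurd hua hne
      · rw [hu p hp] at hne ⊢; exact h.mem p hp hne hpI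

/-- A new largest point may be joined to the largest defect. -/
theorem exists_join {a : α} {P : Finset α} (ha : ∀ x ∈ P, x < a) {m : α → α}
    (hm : IsPartialMatching P m) {d : ℕ} (hd : (defects P m).card = d + 1) :
    ∃ m', IsPartialMatching (insert a P) m' ∧ (defects (insert a P) m').card = d ∧
      ∀ I ⊆ P, matchFun R (insert a P) m' (insert a I) = matchFun R P m I := by
  have hne0 : (defects P m).Nonempty := Finset.card_pos.mp (by omega)
  -- The choice of the largest defect ensures that the new edge covers no other defect.
  set r := (defects P m).max' hne0 with hr
  have hrd : r ∈ defects P m := Finset.max'_mem _ _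
  have hrP : r ∈ P := (Finset.mem_filter.mp hrd).1
  have hmr : m r = r := (Finset.mem_filter.mp hrd).2
  have hmax : ∀ x ∈ P, m x = x → x ≤ r := fun x hx hx' =>
    Finset.le_max' (defects P m) x (Finset.mem_filter.mpr ⟨hx, hx'⟩)
  have hra : r < a := ha r hrP
  have haP : a ∉ P := fun h => lt_irrefl _ (ha a h)
  let m' : α → α := Function.update (Function.update m a r) r a
  have hm'r : m' r = a := Function.update_self _ _ _
  have hm'a : m' a = r := by
    simp only [m']
    rw [Function.update_of_ne hra.ne', Function.update_self]
  have hu : ∀ x ∈ P, x ≠ r → m' x = m x := fun x hx h => by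
    simp only [m']
    rw [Function.update_of_ne h, Function.update_of_ne (ha x hx).ne]
  have hmne : ∀ x ∈ P, x ≠ r → m x ≠ r := fun x hx h e => h (by
    rw [← hm.invol x hx, e, hmr])
  refine ⟨m', ⟨?_, ?_, ?_⟩, ?_, ?_⟩
  · intro p hp
    rcases Finset.mem_insert.mp hp with rfl | hp
    · rw [hm'a]; exact Finset.mem_insert_of_mem hrP
    · by_cases e : p = r
      · rw [e, hm'r]; exact Finset.mem_insert_self _ _
      · rw [hu p hp e]; exact Finset.mem_insert_of_mem (hm.mem p hp)
  · intro p hp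
    rcases Finset.mem_insert.mp hp with rfl | hp
    · rw [hm'a, hm'r]
    · by_cases e : p = r
      · rw [e, hm'r, hm'a]
      · rw [hu p hp e, hu _ (hm.mem p hp) (hmne p hp e), hm.invol p hp]
  · intro p hp q hq h1 h2
    rcases Finset.mem_insert.mp hp with rfl | hp
    · rw [hm'a] at h2
      exact absurd (h1.trans h2) (lt_asymm hra)
    rcases Finset.mem_insert.mp hq with hqa | hq
    · rw [hqa] at h2
      by_cases e : p = r
      · rw [e, hm'r] at h2; exact absurd h2 (lt_irrefl _)
      · rw [hu p hp e] at h2; exact absurd h2 (lt_asymm (ha _ (hm.mem p hp)))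
    by_cases e : p = r
    · subst e
      have hqr : q ≠ r := h1.ne'
      have hmq : m q ≠ q := fun e => absurd h1 (not_lt.mpr (hmax q hq e))
      rw [hm'r, hu q hq hqr]
      refine ⟨?_, ha _ (hm.mem q hq), hmq⟩
      -- Otherwise the edge of `q` would cover the defect `r`.
      by_contra hlt
      have hlt' : m q < r := lt_of_le_of_ne (not_lt.mp hlt) (hmne q hq hqr)
      have := hm.nested (m q) (hm.mem q hq) r hrP hlt' (by rwa [hm.invol q hq])
      exact this.2.2 hmr
    · rw [hu p hp e] at h2 ⊢
      have h3 := hm.nested p hp q hq h1 h2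
      have : q ≠ r := fun e => h3.2.2 (e ▸ hmr)
      rwa [hu q hq this]
  · have : defects (insert a P) m' = (defects P m).erase r := by
      ext x
      simp only [defects, Finset.mem_filter, Finset.mem_insert, Finset.mem_erase]
      constructor
      · rintro ⟨rfl | hx, hx'⟩
        · exact absurd (hm'a.symm.trans hx') hra.ne
        · have hxr : x ≠ r := by
            rintro rfl
            exact hra.ne' (hm'r.symm.trans hx')
          rw [hu x hx hxr] at hx'
          exact ⟨hxr, hx, hx'⟩
      · rintro ⟨h1, h2, h3⟩
        exact ⟨Or.inr h2, by rw [hu x h2 h1, h3]⟩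
    rw [this, Finset.card_erase_of_mem hrd, hd, Nat.add_sub_cancel]
  · intro I hI
    have haI : a ∉ I := fun h => haP (hI h)
    have hins : ∀ {x}, x ∈ P → (x ∈ insert a I ↔ x ∈ I) := fun {x} hx => by
      rw [Finset.mem_insert, or_iff_right (ha x hx).ne]
    unfold matchFun
    congr 1
    refine propext ⟨fun h => ⟨hI, ?_, ?_⟩, fun h => ⟨?_, ?_, ?_⟩⟩
    · intro p hp hpI
      have h1 := h.notMem p (Finset.mem_insert_of_mem hp) ((hins hp).mpr hpI)
      by_cases e : p = r
      · rw [e, hm'r] at h1; exact absurd (Finset.mem_insert_self _ _) h1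
      · rwa [hu p hp e, hins (hm.mem p hp)] at h1
    · intro p hp hne hpI
      have e : p ≠ r := fun e => hne (e ▸ hmr)
      have h1 := h.mem p (Finset.mem_insert_of_mem hp) (by rwa [hu p hp e]) (by rwa [hins hp])
      rwa [hu p hp e, hins (hm.mem p hp)] at h1
    · exact Finset.insert_subset_insert _ hI
    · intro p hp hpI
      rcases Finset.mem_insert.mp hp with rfl | hp
      · rw [hm'a, hins hrP]
        exact fun h1 => h.notMem r hrP h1 (by rwa [hmr])
      · rw [hins hp] at hpI
        have e : p ≠ r := by
          rintro rfl
          exact h.notMem r hrP hpI (by rwa [hmr])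
        rw [hu p hp e, hins (hm.mem p hp)]
        exact h.notMem p hp hpI
    · intro p hp hne hpI
      rcases Finset.mem_insert.mp hp with rfl | hp
      · exact absurd (Finset.mem_insert_self _ _) hpI
      · by_cases e : p = r
        · rw [e, hm'r]; exact Finset.mem_insert_self _ _
        · rw [hins hp] at hpI
          rw [hu p hp e] at hne ⊢
          rw [hins (hm.mem p hp)]
          exact h.mem p hp hne hpI

theorem exists_mem_matchSpan_join {a : α} {P : Finset α} (ha : ∀ x ∈ P, x < a) {d : ℕ}
    {F : Finset α → R} (hF : F ∈ matchSpan R P (d + 1)) :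
    ∃ G ∈ matchSpan R (insert a P) d, ∀ I ⊆ P, G (insert a I) = F I := by
  induction hF using Submodule.span_induction with
  | mem x h =>
    obtain ⟨m, hm, hd, rfl⟩ := h
    obtain ⟨m', hm', hd', h'⟩ := exists_join (R := R) ha hm hd
    exact ⟨_, Submodule.subset_span ⟨m', hm', hd', rfl⟩, h'⟩
  | zero => exact ⟨0, Submodule.zero_mem _, fun _ _ => rfl⟩
  | add x y _ _ hx hy =>
    obtain ⟨G, hG, h1⟩ := hx
    obtain ⟨G', hG', h2⟩ := hy
    exact ⟨G + G', Submodule.add_mem _ hG hG', fun I hI => by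
      rw [Pi.add_apply, Pi.add_apply, h1 I hI, h2 I hI]⟩
  | smul c x _ hx =>
    obtain ⟨G, hG, h1⟩ := hx
    exact ⟨c • G, Submodule.smul_mem _ c hG, fun I hI => by
      rw [Pi.smul_apply, Pi.smul_apply, h1 I hI]⟩

theorem mem_matchSpan_push {a : α} {P : Finset α} (ha : ∀ x ∈ P, x < a) {d : ℕ}
    {F : Finset α → R} (hF : F ∈ matchSpan R P d) :
    (fun I => if a ∈ I then 0 else F I) ∈ matchSpan R (insert a P) (d + 1) := by
  induction hF using Submodule.span_induction with
  | mem x h =>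
    obtain ⟨m, hm, hd, rfl⟩ := h
    refine Submodule.subset_span ⟨_, hm.push ha, by rw [defects_push ha, hd], ?_⟩
    exact funext fun I => (matchFun_push ha I).symm
  | zero =>
    convert Submodule.zero_mem _ using 1
    ext I; simp
  | add x y _ _ hx hy =>
    convert Submodule.add_mem _ hx hy using 1
    ext I; by_cases h : a ∈ I <;> simp [h]
  | smul c x _ hx =>
    convert Submodule.smul_mem _ c hx using 1
    ext I; by_cases h : a ∈ I <;> simp [h]

/-- Highest weight functions are combinations of noncrossing partial matchings. -/
theorem mem_matchSpan [IsDomain R] [CharZero R] (P : Finset α) :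
    ∀ (d : ℕ) (F : Finset α → R), (∀ I, F I ≠ 0 → I ⊆ P ∧ P.card = 2 * I.card + d) →
      (∀ I ⊆ P, raising P F I = 0) → F ∈ matchSpan R P d := by
  induction P using Finset.induction_on_max with
  | empty =>
    intro d F hF _
    by_cases h0 : F ∅ = 0
    · convert Submodule.zero_mem _ using 1
      ext I
      by_contra hne
      have := (hF I hne).1
      rw [Finset.subset_empty.mp this] at hne
      exact hne h0
    · have hd : d = 0 := by have := (hF ∅ h0).2; simp at this; omega
      subst hd
      have hm : IsPartialMatching (∅ : Finset α) id := ⟨by simp, by simp, by simp⟩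
      have : F = F ∅ • matchFun R ∅ id := by
        ext I
        by_cases hI : I = ∅
        · subst hI
          have : Compatible (∅ : Finset α) id ∅ := ⟨by simp, by simp, by simp⟩
          simp [matchFun, this]
        · have h1 : F I = 0 := by
            by_contra hne
            exact hI (Finset.subset_empty.mp (hF I hne).1)
          have h2 : ¬ Compatible (∅ : Finset α) id I := fun h =>
            hI (Finset.subset_empty.mp h.subset)
          simp [matchFun, h2, h1]
      rw [this]
      exact Submodule.smul_mem _ _ (Submodule.subset_span ⟨id, hm, by simp [defects], rfl⟩)
  | insert a P ha ih =>
    intro d F hF hE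
    have haP : a ∉ P := fun h => lt_irrefl _ (ha a h)
    have hsub : ∀ {I}, I ⊆ P → I ⊆ insert a P := fun h => h.trans (Finset.subset_insert _ _)
    have hins : ∀ {I}, I ⊆ P → insert a I ⊆ insert a P := fun h => Finset.insert_subset_insert _ h
    have hcard : (insert a P).card = P.card + 1 := Finset.card_insert_of_notMem haP
    classical
    -- The restriction of `F` to sets containing `a` is again killed by the raising operator, with
    -- `d + 1` defects. Joining `a` to a defect lifts it back to a combination `G` of matchings.
    obtain ⟨G, hG, hGF⟩ : ∃ G ∈ matchSpan R (insert a P) d,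
        ∀ I ⊆ P, G (insert a I) = F (insert a I) := by
      have h1 : (fun J => if J ⊆ P then F (insert a J) else 0) ∈ matchSpan R P (d + 1) := by
        refine ih (d + 1) _ (fun I hI => ?_) (fun I hI => ?_)
        · by_cases hIP : I ⊆ P
          · simp only [if_pos hIP] at hI
            have := (hF _ hI).2
            rw [Finset.card_insert_of_notMem (fun h => haP (hIP h)), hcard] at this
            exact ⟨hIP, by omega⟩
          · simp [hIP] at hI
        · rw [raising_congr (G := fun J => F (insert a J)) (fun J hJ => by simp [hJ]) hI,
            ← raising_insert_max_mem ha]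
          exact hE _ (hins hI)
      obtain ⟨G, hG, h2⟩ := exists_mem_matchSpan_join ha h1
      exact ⟨G, hG, fun I hI => by rw [h2 I hI, if_pos hI]⟩
    -- The difference vanishes on sets containing `a`, so it is a function on subsets of `P` alone,
    -- still killed by the raising operator.
    set H := F + (-1 : R) • G with hH
    have hHs : ∀ I, H I ≠ 0 → I ⊆ insert a P ∧ (insert a P).card = 2 * I.card + d := by
      intro I hI
      by_cases h1 : F I = 0
      · refine support_of_mem_matchSpan hG I fun h2 => hI ?_
        simp [hH, h1, h2]
      · exact hF I h1
    have hHE : ∀ I ⊆ insert a P, raising (insert a P) H I = 0 := fun I hI => by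
      rw [hH, raising_add, raising_smul, hE I hI, raising_eq_zero_of_mem_matchSpan hG,
        mul_zero, add_zero]
    have hHin : ∀ I ⊆ P, H (insert a I) = 0 := fun I hI => by
      simp [hH, hGF I hI]
    have hHP : ∀ I, H I ≠ 0 → I ⊆ P ∧ a ∉ I := by
      intro I hI
      have h1 := (hHs I hI).1
      have haI : a ∉ I := fun h => hI (by
        rw [← Finset.insert_erase h]
        exact hHin _ (Finset.subset_insert_iff.mp h1))
      exact ⟨(Finset.subset_insert_iff_of_notMem haI).mp h1, haI⟩
    have hHE' : ∀ I ⊆ P, raising P H I = 0 := fun I hI => by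
      have := raising_insert_max_notMem ha H hI
      rw [hHE I (hsub hI), hHin I hI, mul_zero, add_zero] at this
      exact this.symm
    have hHmem : H ∈ matchSpan R (insert a P) d := by
      -- For `d = 0` the support of `H` has `2 * |I| = |P| + 1`, where the raising operator is
      -- injective, so `H = 0`. For positive `d` the point `a` is added as a new defect.
      rcases d with _ | d
      · have h0 := eq_zero_of_iterate_raising P 1 1 H le_rfl (fun I hI hne => by
          have := (hHs I hne).2; omega) hHE'
        convert Submodule.zero_mem _ using 1
        ext I
        by_contra hne
        exact hne (h0 I (hHP I hne).1)
      · have h1 : H ∈ matchSpan R P d := ih d H (fun I hI => ⟨(hHP I hI).1, by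
          have := (hHs I hI).2; omega⟩) hHE'
        convert mem_matchSpan_push ha h1 using 1
        ext I
        by_cases h : a ∈ I
        · rw [if_pos h]
          by_contra hne
          exact (hHP I hne).2 h
        · rw [if_neg h]
    have : F = H + G := by
      ext I; simp [hH]
    rw [this]
    exact Submodule.add_mem _ hHmem hG

end Matchings

end BicolouredPaths

namespace BicolouredPaths

/-! ### Hopping particles and the fermionic bilinear relation. -/

section Amplitudes

variable {R : Type*} [CommRing R]

/-- The sign of the number of elements of `B` to the left of `q`. -/
def leftSign (R : Type*) [CommRing R] (B : Finset ℤ) (q : ℤ) : R := (-1) ^ (B.filter (· < q)).card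

theorem leftSign_insert_of_le {B : Finset ℤ} {p q : ℤ} (h : q ≤ p) :
    leftSign R (insert p B) q = leftSign R B q := by
  unfold leftSign
  rw [Finset.filter_insert, if_neg (not_lt.mpr h)]

theorem leftSign_insert_of_lt {B : Finset ℤ} {p q : ℤ} (hp : p ∉ B) (h : p < q) :
    leftSign R (insert p B) q = -leftSign R B q := by
  unfold leftSign
  rw [Finset.filter_insert, if_pos h, Finset.card_insert_of_notMem
    (fun h => hp (Finset.mem_filter.mp h).1), pow_succ]
  ring

theorem leftSign_erase_of_le {B : Finset ℤ} {p q : ℤ} (h : q ≤ p) :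
    leftSign R (B.erase p) q = leftSign R B q := by
  by_cases hp : p ∈ B
  · conv_rhs => rw [← Finset.insert_erase hp, leftSign_insert_of_le h]
  · rw [Finset.erase_eq_of_notMem hp]

theorem leftSign_erase_of_lt {B : Finset ℤ} {p q : ℤ} (hp : p ∈ B) (h : p < q) :
    leftSign R (B.erase p) q = -leftSign R B q := by
  conv_rhs => rw [← Finset.insert_erase hp, leftSign_insert_of_lt (Finset.notMem_erase p B) h]
  rw [neg_neg]

theorem leftSign_succ_of_notMem {B : Finset ℤ} {c : ℤ} (h : c ∉ B) :
    leftSign R B (c + 1) = leftSign R B c := by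
  unfold leftSign
  congr 2
  refine Finset.filter_congr fun x hx => ?_
  have : x ≠ c := fun e => h (e ▸ hx)
  omega

theorem leftSign_succ_of_mem {B : Finset ℤ} {c : ℤ} (h : c ∈ B) :
    leftSign R B (c + 1) = -leftSign R B c := by
  rw [← leftSign_erase_of_le (le_refl c), ← leftSign_succ_of_notMem (Finset.notMem_erase c B),
    leftSign_erase_of_lt h (lt_add_one c), neg_neg]

/-- The set `B` with the particle at `c + 1` moved back to `c`. -/
def moveBack (c : ℤ) (B : Finset ℤ) : Finset ℤ := insert c (B.erase (c + 1))

theorem mem_moveBack {c q : ℤ} {B : Finset ℤ} (h1 : q ≠ c) (h2 : q ≠ c + 1) :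
    q ∈ moveBack c B ↔ q ∈ B := by
  simp [moveBack, h1, h2]

theorem leftSign_moveBack {c q : ℤ} {B : Finset ℤ} (h1 : c + 1 ∈ B) (h2 : c ∉ B)
    (hq : q ≠ c + 1) : leftSign R (moveBack c B) q = leftSign R B q := by
  unfold moveBack
  have h2' : c ∉ B.erase (c + 1) := fun h => h2 (Finset.mem_of_mem_erase h)
  rcases le_or_gt q c with h | h
  · rw [leftSign_insert_of_le h, leftSign_erase_of_le (by omega)]
  · rw [leftSign_insert_of_lt h2' h, leftSign_erase_of_lt h1 (by omega), neg_neg]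

/-- The operator allowing a particle to move from `c` to `c + 1`, with weight `y`. -/
def moveOp (c : ℤ) (y : R) (g : Finset ℤ → R) (B : Finset ℤ) : R :=
  g B + (if c + 1 ∈ B ∧ c ∉ B then y else 0) * g (moveBack c B)

/-- The operator evaluating at the set with one more particle, at `q`. -/
def addOp (q : ℤ) (g : Finset ℤ → R) (B : Finset ℤ) : R :=
  if q ∉ B then leftSign R B q * g (insert q B) else 0

/-- The operator evaluating at the set with the particle at `q` removed. -/
def removeOp (q : ℤ) (g : Finset ℤ → R) (B : Finset ℤ) : R :=
  if q ∈ B then leftSign R B q * g (B.erase q) else 0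

theorem moveOp_addOp {c q : ℤ} (y : R) (g : Finset ℤ → R) (B : Finset ℤ) (hq : q ≠ c + 1) :
    moveOp c y (addOp q g) B = addOp q (moveOp c y g) B := by
  by_cases hqc : q = c
  · subst hqc
    simp [moveOp, addOp, moveBack]
  · simp only [moveOp, addOp, mem_moveBack hqc hq]
    by_cases hqB : q ∈ B
    · simp [hqB]
    · simp only [hqB, not_false_eq_true, if_true, Finset.mem_insert, Ne.symm hq, Ne.symm hqc,
        false_or]
      by_cases h : c + 1 ∈ B ∧ c ∉ B
      · rw [if_pos h, leftSign_moveBack h.1 h.2 hq]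
        have : insert q (moveBack c B) = moveBack c (insert q B) := by
          unfold moveBack
          rw [Finset.erase_insert_of_ne hq, Finset.insert_comm]
        rw [this]
        ring
      · rw [if_neg h]
        ring

theorem moveOp_addOp_succ (c : ℤ) (y : R) (g : Finset ℤ → R) (B : Finset ℤ) :
    moveOp c y (addOp (c + 1) g) B =
      addOp (c + 1) (moveOp c y g) B - y * addOp c (moveOp c y g) B := by
  by_cases hc : c ∈ B
  · simp [moveOp, addOp, hc]
  · by_cases hc1 : c + 1 ∈ B
    · have h1 : c + 1 ∉ moveBack c B := by simp [moveBack]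
      have h2 : insert (c + 1) (moveBack c B) = insert c B := by
        unfold moveBack
        rw [Finset.insert_comm, Finset.insert_erase hc1]
      have h3 : leftSign R (moveBack c B) (c + 1) = -leftSign R B c := by
        unfold moveBack
        rw [leftSign_succ_of_mem (Finset.mem_insert_self _ _), leftSign_insert_of_le le_rfl,
          leftSign_erase_of_le (by omega)]
      simp [moveOp, addOp, hc, hc1, h1, h2, h3]
    · have h2 : moveBack c (insert (c + 1) B) = insert c B := by
        unfold moveBack
        rw [Finset.erase_insert hc1]
      simp [moveOp, addOp, hc, hc1, h2, leftSign_succ_of_notMem hc]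
      ring

theorem moveOp_removeOp {c q : ℤ} (y : R) (g : Finset ℤ → R) (B : Finset ℤ) (hq : q ≠ c) :
    moveOp c y (removeOp q g) B = removeOp q (moveOp c y g) B := by
  by_cases hqc : q = c + 1
  · subst hqc
    simp [moveOp, removeOp, moveBack]
  · simp only [moveOp, removeOp, mem_moveBack hq hqc]
    by_cases hqB : q ∈ B
    · simp only [hqB, if_true, Finset.mem_erase, ne_eq, Ne.symm hq, Ne.symm hqc,
        not_false_eq_true, true_and]
      by_cases h : c + 1 ∈ B ∧ c ∉ B
      · rw [if_pos h, leftSign_moveBack h.1 h.2 hqc]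
        have : (moveBack c B).erase q = moveBack c (B.erase q) := by
          unfold moveBack
          rw [Finset.erase_insert_of_ne (Ne.symm hq), Finset.erase_right_comm]
        rw [this]
        ring
      · rw [if_neg h]
        ring
    · simp [hqB]

theorem moveOp_removeOp_self (c : ℤ) (y : R) (g : Finset ℤ → R) (B : Finset ℤ) :
    moveOp c y (removeOp c g) B =
      removeOp c (moveOp c y g) B + y * removeOp (c + 1) (moveOp c y g) B := by
  by_cases hc1 : c + 1 ∈ B
  · by_cases hc : c ∈ B
    · have h2 : moveBack c (B.erase c) = B.erase (c + 1) := by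
        unfold moveBack
        rw [Finset.erase_right_comm, Finset.insert_erase]
        simp [hc]
      simp [moveOp, removeOp, hc, hc1, h2, leftSign_succ_of_mem hc]
      ring
    · have h2 : (moveBack c B).erase c = B.erase (c + 1) := by
        unfold moveBack
        rw [Finset.erase_insert]
        simp [hc]
      have h3 : leftSign R (moveBack c B) c = leftSign R B (c + 1) := by
        rw [leftSign_moveBack hc1 hc (by omega), leftSign_succ_of_notMem hc]
      have h4 : c ∈ moveBack c B := Finset.mem_insert_self _ _
      simp [moveOp, removeOp, hc, hc1, h2, h3, h4]
  · simp [moveOp, removeOp, hc1]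

/-- A move commutes with adding except at `q = c + 1` and with removing except at `q = c`. The two
corrections are `y` times the product of adding at `c` and removing at `c + 1`, with opposite signs,
and cancel once both indices lie in `U`. -/
theorem sum_addOp_mul_removeOp_moveOp {U : Finset ℤ} {c : ℤ} (hc : c ∈ U) (hc1 : c + 1 ∈ U)
    (y : R) (g g' : Finset ℤ → R) (B B' : Finset ℤ) :
    ∑ q ∈ U, addOp q (moveOp c y g) B * removeOp q (moveOp c y g') B' =
      ∑ q ∈ U, moveOp c y (addOp q g) B * moveOp c y (removeOp q g') B' := by
  have h1 : ∀ q, moveOp c y (addOp q g) B = addOp q (moveOp c y g) B -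
      if q = c + 1 then y * addOp c (moveOp c y g) B else 0 := by
    intro q
    by_cases h : q = c + 1
    · rw [if_pos h, h, moveOp_addOp_succ]
    · rw [if_neg h, sub_zero, moveOp_addOp y g B h]
  have h2 : ∀ q, moveOp c y (removeOp q g') B' = removeOp q (moveOp c y g') B' +
      if q = c then y * removeOp (c + 1) (moveOp c y g') B' else 0 := by
    intro q
    by_cases h : q = c
    · rw [if_pos h, h, moveOp_removeOp_self]
    · rw [if_neg h, add_zero, moveOp_removeOp y g' B' h]
  have h3 : ∀ q ∈ U, moveOp c y (addOp q g) B * moveOp c y (removeOp q g') B' =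
      addOp q (moveOp c y g) B * removeOp q (moveOp c y g') B' +
      (if q = c then
        addOp c (moveOp c y g) B * (y * removeOp (c + 1) (moveOp c y g') B') else 0) -
      (if q = c + 1 then
        y * addOp c (moveOp c y g) B * removeOp (c + 1) (moveOp c y g') B' else 0) := by
    intro q _
    rw [h1, h2]
    by_cases ha : q = c
    · have : q ≠ c + 1 := by omega
      rw [if_pos ha, if_neg this, if_pos ha, if_neg this, ha]
      ring
    · by_cases hb : q = c + 1
      · rw [if_neg ha, if_pos hb, if_neg ha, if_pos hb, hb]
        ring
      · rw [if_neg ha, if_neg hb, if_neg ha, if_neg hb]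
        ring
  rw [Finset.sum_congr rfl h3, Finset.sum_sub_distrib, Finset.sum_add_distrib,
    Finset.sum_ite_eq', Finset.sum_ite_eq', if_pos hc, if_pos hc1]
  ring

/-- The total weight of the ways of moving particles from `A` to `B`, one step for each of the
letters `(c, y)` of a word, read from the end; the letter `(c, y)` allows the step from `c` to
`c + 1`, with weight `y`. -/
def amplitude : List (ℤ × R) → Finset ℤ → Finset ℤ → R
  | [], A, B => if A = B then 1 else 0
  | l :: w, A, B => moveOp l.1 l.2 (amplitude w A) B

/-- The particle transferred between the two systems may be moved at the start or at the end of the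
evolution. This is the source of all relations between products of Schur functions used below. -/
theorem sum_amplitude_mul_amplitude {U : Finset ℤ} (w : List (ℤ × R))
    (hw : ∀ l ∈ w, l.1 ∈ U ∧ l.1 + 1 ∈ U) (A A' B B' : Finset ℤ) :
    ∑ p ∈ U, (if p ∈ A ∧ p ∉ A' then leftSign R A p * leftSign R A' p else 0) *
        (amplitude w (A.erase p) B * amplitude w (insert p A') B') =
      ∑ q ∈ U, addOp q (amplitude w A) B * removeOp q (amplitude w A') B' := by
  induction w generalizing B B' with
  | nil =>
    -- Without moves the two sides agree term by term, with `p = q`.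
    refine Finset.sum_congr rfl fun q _ => ?_
    simp only [amplitude, addOp, removeOp]
    by_cases h1 : q ∈ A ∧ A.erase q = B
    · have h1' : q ∉ B := by rw [← h1.2]; exact Finset.notMem_erase q A
      have h1'' : A = insert q B := by rw [← h1.2, Finset.insert_erase h1.1]
      by_cases h2 : q ∉ A' ∧ insert q A' = B'
      · have h2' : q ∈ B' := by rw [← h2.2]; exact Finset.mem_insert_self q A'
        have h2'' : A' = B'.erase q := by rw [← h2.2, Finset.erase_insert h2.1]
        rw [if_pos ⟨h1.1, h2.1⟩, if_pos h1.2, if_pos h2.2, if_pos h1', if_pos h2', if_pos h1'',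
          if_pos h2'', h1'', h2'', leftSign_insert_of_le le_rfl, leftSign_erase_of_le le_rfl]
        ring
      · have h3 : ¬ (q ∈ B' ∧ A' = B'.erase q) := fun h => h2
          ⟨h.2 ▸ Finset.notMem_erase q B', by rw [h.2, Finset.insert_erase h.1]⟩
        rw [not_and] at h2 h3
        by_cases h4 : q ∈ A' <;> by_cases h5 : q ∈ B' <;>
          simp [h4, h5, h2, h3]
    · have h3 : ¬ (q ∉ B ∧ A = insert q B) := fun h => h1
        ⟨h.2 ▸ Finset.mem_insert_self q B, by rw [h.2, Finset.erase_insert h.1]⟩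
      rw [not_and] at h1 h3
      by_cases h4 : q ∈ A <;> by_cases h5 : q ∈ B <;> simp [h4, h5, h1, h3]
  | cons l w ih =>
    have ih' := ih fun l' hl' => hw l' (List.mem_cons_of_mem _ hl')
    obtain ⟨hc, hc1⟩ := hw l List.mem_cons_self
    change _ = ∑ q ∈ U, addOp q (moveOp l.1 l.2 (amplitude w A)) B *
      removeOp q (moveOp l.1 l.2 (amplitude w A')) B'
    rw [sum_addOp_mul_removeOp_moveOp hc hc1]
    simp only [amplitude, moveOp]
    -- The weights of the last move do not depend on the summation index. The sum therefore splits
    -- into four instances of the induction hypothesis, one for each choice of moving or not moving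
    -- back in `B` and in `B'`.
    have e1 : ∀ (a b c d s t : R), (a + s * b) * (c + t * d) =
        a * c + t * (a * d) + s * (b * c) + s * t * (b * d) := fun _ _ _ _ _ _ => by ring
    have e2 : ∀ (k a b c d s t : R), k * (a * c + t * (a * d) + s * (b * c) + s * t * (b * d)) =
        k * (a * c) + t * (k * (a * d)) + s * (k * (b * c)) + s * t * (k * (b * d)) :=
      fun _ _ _ _ _ _ _ => by ring
    simp only [e1, e2, Finset.sum_add_distrib, ← Finset.mul_sum, ih']

theorem card_moveBack {c : ℤ} {B : Finset ℤ} (h1 : c + 1 ∈ B) (h2 : c ∉ B) :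
    (moveBack c B).card = B.card := by
  unfold moveBack
  rw [Finset.card_insert_of_notMem (fun h => h2 (Finset.mem_of_mem_erase h)),
    Finset.card_erase_add_one h1]

/-- Particles only move to the right, and their number does not change. -/
theorem card_filter_le_of_amplitude_ne_zero (w : List (ℤ × R)) (A B : Finset ℤ)
    (h : amplitude w A B ≠ 0) : A.card = B.card ∧
      ∀ z, (A.filter (z ≤ ·)).card ≤ (B.filter (z ≤ ·)).card := by
  induction w generalizing B with
  | nil =>
    have : A = B := by
      by_contra hne
      exact h (if_neg hne)
    subst this
    exact ⟨rfl, fun _ => le_rfl⟩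
  | cons l w ih =>
    by_cases h0 : amplitude w A B = 0
    · have hc : l.1 + 1 ∈ B ∧ l.1 ∉ B := by
        by_contra hc
        exact h (by simp [amplitude, moveOp, h0, hc])
      have h1 : amplitude w A (moveBack l.1 B) ≠ 0 := fun h1 => h (by
        simp [amplitude, moveOp, h0, h1])
      obtain ⟨h2, h3⟩ := ih _ h1
      refine ⟨h2.trans (card_moveBack hc.1 hc.2), fun z => (h3 z).trans ?_⟩
      unfold moveBack
      rw [Finset.filter_insert]
      split_ifs with hz
      · rw [Finset.card_insert_of_notMem (fun h => hc.2
          (Finset.mem_of_mem_erase (Finset.mem_filter.mp h).1)), Finset.filter_erase,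
          Finset.card_erase_add_one (Finset.mem_filter.mpr ⟨hc.1, by omega⟩)]
      · exact Finset.card_le_card (Finset.filter_subset_filter _ (Finset.erase_subset _ _))
    · exact ih _ h0

end Amplitudes

end BicolouredPaths

namespace BicolouredPaths

/-! ### Skew tableaux as histories of hopping particles. -/

section Tableaux

variable {N : ℕ}

/-- The content of a cell, shifted so that adding the cell moves a particle from its content to the
next integer. -/
def shiftedContent (t : ℤ) (d : ℕ × ℕ) : ℤ := (d.2 : ℤ) - (d.1 + 1) + t

/-- Weakly increasing rows and strictly increasing columns. -/
def IsSemistandard (C : Finset (ℕ × ℕ)) (T : ↥C → Fin N) : Prop :=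
  (∀ c d : ↥C, c.1.1 = d.1.1 → c.1.2 < d.1.2 → T c ≤ T d) ∧
  (∀ c d : ↥C, c.1.2 = d.1.2 → c.1.1 < d.1.1 → T c < T d)

/-- Every pair of an entry and the content of its cell occurs in the word `w`. -/
def HasLettersIn (t : ℤ) (C : Finset (ℕ × ℕ)) (w : List (Fin N × ℤ)) (T : ↥C → Fin N) : Prop :=
  ∀ d : ↥C, (T d, shiftedContent t d) ∈ w

open scoped Classical in
/-- The generating function of semistandard fillings with letters in the word `w`. -/
noncomputable def tableauSum (t : ℤ) (C : Finset (ℕ × ℕ)) (w : List (Fin N × ℤ)) :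
    MvPolynomial (Fin N) ℤ :=
  ∑ T : ↥C → Fin N with IsSemistandard C T ∧ HasLettersIn t C w T, ∏ c, MvPolynomial.X (T c)

/-- The lexicographic order on letters. -/
def LetterLT (l l' : Fin N × ℤ) : Prop := l.1 < l'.1 ∨ l.1 = l'.1 ∧ l.2 < l'.2

theorem tableauSum_nil (t : ℤ) (C : Finset (ℕ × ℕ)) :
    tableauSum (N := N) t C [] = if C = ∅ then 1 else 0 := by
  classical
  unfold tableauSum
  split_ifs with h
  · subst h
    rw [Finset.filter_true_of_mem]
    · simp
    · intro T _
      exact ⟨⟨fun c => absurd c.2 (Finset.notMem_empty _),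
        fun c => absurd c.2 (Finset.notMem_empty _)⟩, fun c => absurd c.2 (Finset.notMem_empty _)⟩
  · obtain ⟨d, hd⟩ := Finset.nonempty_iff_ne_empty.mpr h
    rw [Finset.filter_false_of_mem, Finset.sum_empty]
    intro T _ hT
    exact absurd (hT.2 ⟨d, hd⟩) List.not_mem_nil

theorem tableauSum_cons_of_unused {t : ℤ} {C : Finset (ℕ × ℕ)} {l : Fin N × ℤ}
    {w : List (Fin N × ℤ)} (h : ∀ T : ↥C → Fin N, IsSemistandard C T → HasLettersIn t C (l :: w) T →
      ∀ d, (T d, shiftedContent t d) ≠ l) :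
    tableauSum t C (l :: w) = tableauSum t C w := by
  classical
  unfold tableauSum
  refine Finset.sum_congr (Finset.filter_congr fun T _ => and_congr_right fun hT => ⟨?_, ?_⟩)
    fun _ _ => rfl
  · exact fun hL d => (List.mem_cons.mp (hL d)).resolve_left (h T hT hL d)
  · exact fun hL d => List.mem_cons_of_mem _ (hL d)

theorem prod_eq_mul_prod_erase {M : Type*} [CommMonoid M] {C : Finset (ℕ × ℕ)} {d : ℕ × ℕ}
    (hd : d ∈ C) (f : ↥C → M) :
    ∏ c, f c = f ⟨d, hd⟩ * ∏ c : ↥(C.erase d), f ⟨c.1, Finset.mem_of_mem_erase c.2⟩ := by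
  classical
  rw [← Finset.mul_prod_erase Finset.univ f (Finset.mem_univ ⟨d, hd⟩)]
  congr 1
  refine (Finset.prod_bij (fun c _ => (⟨c.1, Finset.mem_of_mem_erase c.2⟩ : ↥C)) ?_ ?_ ?_ ?_).symm
  · intro c _
    rw [Finset.mem_erase]
    exact ⟨fun e => (Finset.mem_erase.mp c.2).1 (congrArg Subtype.val e), Finset.mem_univ _⟩
  · intro c _ c' _ e
    exact Subtype.ext (Subtype.mk.inj e)
  · intro c hc
    exact ⟨⟨c.1, Finset.mem_erase.mpr ⟨fun e => (Finset.mem_erase.mp hc).1 (Subtype.ext e), c.2⟩⟩,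
      Finset.mem_univ _, rfl⟩
  · exact fun _ _ => rfl

/-- The fillings are split by whether the corner `d` carries the largest entry `l.1`. If it does,
deleting `d` gives a filling that no longer uses `l`. Otherwise `huniq` shows that `l` is not used
at all. -/
theorem tableauSum_cons_of_corner {t : ℤ} {C : Finset (ℕ × ℕ)} {l : Fin N × ℤ}
    {w : List (Fin N × ℤ)} (hw : ∀ l' ∈ w, LetterLT l' l) {d : ℕ × ℕ} (hd : d ∈ C)
    (hdl : shiftedContent t d = l.2)
    (hright : ∀ e ∈ C, e.1 = d.1 → e.2 ≤ d.2) (hbelow : ∀ e ∈ C, e.2 = d.2 → e.1 ≤ d.1)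
    (huniq : ∀ T : ↥C → Fin N, IsSemistandard C T → HasLettersIn t C (l :: w) T →
      ∀ e : ↥C, (T e, shiftedContent t e) = l → e.1 = d) :
    tableauSum t C (l :: w) =
      tableauSum t C w + MvPolynomial.X l.1 * tableauSum t (C.erase d) w := by
  classical
  have hirr : l ∉ w := fun h => by
    rcases hw l h with h | h
    · exact lt_irrefl _ h
    · exact lt_irrefl _ h.2
  unfold tableauSum
  rw [← Finset.sum_filter_not_add_sum_filter _ (fun T : ↥C → Fin N => T ⟨d, hd⟩ = l.1)]
  congr 1
  · rw [Finset.filter_filter]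
    refine Finset.sum_congr (Finset.filter_congr fun T _ => ⟨?_, ?_⟩) fun _ _ => rfl
    · rintro ⟨⟨h1, h2⟩, h3⟩
      refine ⟨h1, fun e => (List.mem_cons.mp (h2 e)).resolve_left fun he => h3 ?_⟩
      have h4 := huniq T h1 h2 e he
      have h5 : e = ⟨d, hd⟩ := Subtype.ext h4
      rw [← h5, ← he]
    · rintro ⟨h1, h2⟩
      refine ⟨⟨h1, fun e => List.mem_cons_of_mem _ (h2 e)⟩, fun h3 => hirr ?_⟩
      have h4 := h2 ⟨d, hd⟩
      rw [h3, hdl] at h4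
      exact h4
  · rw [Finset.mul_sum, Finset.filter_filter]
    refine Finset.sum_bij'
      (fun T _ => fun e : ↥(C.erase d) => T ⟨e.1, Finset.mem_of_mem_erase e.2⟩)
      (fun T _ => fun e : ↥C =>
        if h : e.1 = d then l.1 else T ⟨e.1, Finset.mem_erase.mpr ⟨h, e.2⟩⟩) ?_ ?_ ?_ ?_ ?_
    · intro T hT
      simp only [Finset.mem_filter, Finset.mem_univ, true_and] at hT ⊢
      obtain ⟨⟨h1, h2⟩, h3⟩ := hT
      refine ⟨⟨fun e f => h1.1 ⟨e, _⟩ ⟨f, _⟩, fun e f => h1.2 ⟨e, _⟩ ⟨f, _⟩⟩, fun e => ?_⟩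
      exact (List.mem_cons.mp (h2 _)).resolve_left fun he =>
        (Finset.mem_erase.mp e.2).1 (huniq T h1 h2 _ he)
    · intro T hT
      simp only [Finset.mem_filter, Finset.mem_univ, true_and] at hT ⊢
      obtain ⟨h1, h2⟩ := hT
      refine ⟨⟨⟨?_, ?_⟩, ?_⟩, ?_⟩
      · intro e f hef hlt
        by_cases he : e.1 = d
        · exact absurd (hright f f.2 (by rw [← hef, he])) (by rw [← he]; exact not_le.mpr hlt)
        · by_cases hf : f.1 = d
          · simp only [he, hf, dif_pos, dif_neg, not_false_eq_true]
            rcases hw _ (h2 ⟨e.1, Finset.mem_erase.mpr ⟨he, e.2⟩⟩) with h | h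
            · exact h.le
            · exact h.1.le
          · simp only [he, hf, dif_neg, not_false_eq_true]
            exact h1.1 _ _ hef hlt
      · intro e f hef hlt
        by_cases he : e.1 = d
        · exact absurd (hbelow f f.2 (by rw [← hef, he])) (by rw [← he]; exact not_le.mpr hlt)
        · by_cases hf : f.1 = d
          · simp only [he, hf, dif_pos, dif_neg, not_false_eq_true]
            rcases hw _ (h2 ⟨e.1, Finset.mem_erase.mpr ⟨he, e.2⟩⟩) with h | h
            · exact h
            -- An equal entry higher up in the column is impossible: that cell has the larger
            -- content, while letters of `w` with entry `l.1` have content below `l.2`.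
            · exfalso
              have h3 : shiftedContent t e < l.2 := h.2
              rw [← hdl] at h3
              rw [hf] at hef hlt
              simp only [shiftedContent, hef] at h3
              omega
          · simp only [he, hf, dif_neg, not_false_eq_true]
            exact h1.2 _ _ hef hlt
      · intro e
        by_cases he : e.1 = d
        · simp only [he, dif_pos, hdl]
          exact List.mem_cons_self
        · simp only [he, dif_neg, not_false_eq_true]
          exact List.mem_cons_of_mem _ (h2 ⟨e.1, _⟩)
      · simp
    · intro T hT
      simp only [Finset.mem_filter, Finset.mem_univ, true_and] at hT
      funext e
      by_cases he : e.1 = d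
      · have : e = ⟨d, hd⟩ := Subtype.ext he
        simp only [he, dif_pos]
        rw [this, hT.2]
      · simp only [he, dif_neg, not_false_eq_true]
    · intro T hT
      funext e
      simp only [(Finset.mem_erase.mp e.2).1, dif_neg, not_false_eq_true]
    · intro T hT
      simp only [Finset.mem_filter, Finset.mem_univ, true_and] at hT
      rw [prod_eq_mul_prod_erase hd, hT.2]

theorem mem_skew {lam mu : YoungDiagram} {d : ℕ × ℕ} :
    d ∈ lam.cells \ mu.cells ↔ mu.rowLen d.1 ≤ d.2 ∧ d.2 < lam.rowLen d.1 := by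
  rw [Finset.mem_sdiff, YoungDiagram.mem_cells, YoungDiagram.mem_cells,
    ← Prod.mk.eta (p := d), YoungDiagram.mem_iff_lt_rowLen, YoungDiagram.mem_iff_lt_rowLen, not_lt]
  exact and_comm

theorem skewSchur_eq_tableauSum {lam mu : YoungDiagram} (t : ℤ) (w : List (Fin N × ℤ))
    (h : ∀ k : Fin N, ∀ d ∈ lam.cells \ mu.cells, (k, shiftedContent t d) ∈ w) :
    skewSchur N lam mu = tableauSum t (lam.cells \ mu.cells) w := by
  classical
  unfold skewSchur tableauSum skewTableaux
  refine Finset.sum_congr (Finset.filter_congr fun T _ => ?_) fun _ _ => rfl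
  exact ⟨fun hT => ⟨hT, fun d => h _ d d.2⟩, fun hT => hT.1⟩

/-- The largest letter sits in a removable corner of the outer shape. -/
theorem corner_of_last_letter {lam mu : YoungDiagram} {t : ℤ} {l : Fin N × ℤ}
    {w : List (Fin N × ℤ)} (hw : ∀ l' ∈ w, LetterLT l' l)
    {T : ↥(lam.cells \ mu.cells) → Fin N} (hT : IsSemistandard _ T)
    (hL : HasLettersIn t _ (l :: w) T) (d : ↥(lam.cells \ mu.cells))
    (hd : (T d, shiftedContent t d) = l) :
    lam.rowLen d.1.1 = d.1.2 + 1 ∧ lam.rowLen (d.1.1 + 1) ≤ d.1.2 := by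
  have hm := mem_skew.mp d.2
  have hd1 : T d = l.1 := congrArg Prod.fst hd
  have hd2 : shiftedContent t d = l.2 := congrArg Prod.snd hd
  constructor
  · by_contra hne
    -- The right neighbour would have a weakly larger entry and a larger content, hence a letter
    -- beyond `l`.
    let e : ↥(lam.cells \ mu.cells) := ⟨(d.1.1, d.1.2 + 1), mem_skew.mpr ⟨by simp; omega, by
      simp; omega⟩⟩
    have h1 := hT.1 d e rfl (Nat.lt_succ_self _)
    have h3 : shiftedContent t e = l.2 + 1 := by
      rw [← hd2]; simp only [shiftedContent, e]; push_cast; ring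
    rcases List.mem_cons.mp (hL e) with h2 | h2
    · have : shiftedContent t e = l.2 := congrArg Prod.snd h2
      omega
    · rw [hd1] at h1
      rcases hw _ h2 with h | h
      · exact absurd h (not_lt.mpr h1)
      · have := h.2
        simp only at this
        omega
  · by_contra hlt
    have hmu := mu.rowLen_anti d.1.1 (d.1.1 + 1) (Nat.le_succ _)
    let e : ↥(lam.cells \ mu.cells) := ⟨(d.1.1 + 1, d.1.2), mem_skew.mpr ⟨by simp; omega, by
      simp; omega⟩⟩
    have h1 := hT.2 d e rfl (Nat.lt_succ_self _)
    rw [hd1] at h1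
    rcases List.mem_cons.mp (hL e) with h2 | h2
    · exact absurd (congrArg Prod.fst h2) h1.ne'
    · rcases hw _ h2 with h | h
      · exact absurd h (lt_asymm h1)
      · exact absurd h.1 h1.ne'

/-- The point belonging to the row `i` of a diagram. -/
def rowPoint (lam : YoungDiagram) (t : ℤ) (i : ℕ) : ℤ := (lam.rowLen i : ℤ) - (i + 1) + t

theorem rowPoint_strictAnti (lam : YoungDiagram) (t : ℤ) : StrictAnti (rowPoint lam t) := by
  intro i k h
  have := lam.rowLen_anti i k h.le
  unfold rowPoint
  omega

/-- The points belonging to the first `r` rows of a diagram. -/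
def rowPoints (r : ℕ) (lam : YoungDiagram) (t : ℤ) : Finset ℤ :=
  (Finset.range r).image (rowPoint lam t)

theorem mem_rowPoints {r : ℕ} {lam : YoungDiagram} {t x : ℤ} :
    x ∈ rowPoints r lam t ↔ ∃ i < r, rowPoint lam t i = x := by
  simp [rowPoints]

theorem rowPoint_mem {r : ℕ} {lam : YoungDiagram} {t : ℤ} {i : ℕ} (hi : i < r) :
    rowPoint lam t i ∈ rowPoints r lam t := mem_rowPoints.mpr ⟨i, hi, rfl⟩

theorem rowLen_le_of_le {lam mu : YoungDiagram} (h : mu ≤ lam) (i : ℕ) :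
    mu.rowLen i ≤ lam.rowLen i := by
  by_contra hlt
  have h1 : (i, lam.rowLen i) ∈ mu := YoungDiagram.mem_iff_lt_rowLen.mpr (not_le.mp hlt)
  exact lt_irrefl _ (YoungDiagram.mem_iff_lt_rowLen.mp (h h1))

theorem skew_eq_empty_iff {r : ℕ} {lam mu : YoungDiagram} (h : mu ≤ lam) (hr : lam.rowLen r = 0)
    (t : ℤ) : rowPoints r mu t = rowPoints r lam t ↔ lam.cells \ mu.cells = ∅ := by
  constructor
  · intro he
    -- Equal sets have equal sums; together with the rowwise inequality this forces equality in
    -- every row.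
    have hs : ∑ i ∈ Finset.range r, rowPoint mu t i = ∑ i ∈ Finset.range r, rowPoint lam t i := by
      have := congrArg (fun E => ∑ x ∈ E, x) he
      simp only [rowPoints] at this
      rwa [Finset.sum_image (rowPoint_strictAnti mu t).injective.injOn,
        Finset.sum_image (rowPoint_strictAnti lam t).injective.injOn] at this
    have hle : ∀ i ∈ Finset.range r, rowPoint mu t i ≤ rowPoint lam t i := fun i _ => by
      have := rowLen_le_of_le h i
      unfold rowPoint
      omega
    have heq := (Finset.sum_eq_sum_iff_of_le hle).mp hs
    rw [Finset.eq_empty_iff_forall_notMem]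
    intro d hd
    rw [mem_skew] at hd
    have hdr : d.1 < r := by
      by_contra hge
      have := lam.rowLen_anti r d.1 (not_lt.mp hge)
      omega
    have := heq d.1 (Finset.mem_range.mpr hdr)
    unfold rowPoint at this
    omega
  · intro he
    have : ∀ i, rowPoint mu t i = rowPoint lam t i := fun i => by
      have h1 := rowLen_le_of_le h i
      by_contra hne
      have h2 : (i, mu.rowLen i) ∈ lam.cells \ mu.cells := mem_skew.mpr ⟨le_rfl, by
        refine lt_of_le_of_ne h1 fun e => hne ?_
        simp only at e
        unfold rowPoint
        rw [e]⟩
      rw [he] at h2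
      exact absurd h2 (Finset.notMem_empty _)
    unfold rowPoints
    exact Finset.image_congr fun i _ => this i

/-- Removal of a corner from a Young diagram. -/
def removeCorner (lam : YoungDiagram) (i : ℕ) (h : lam.rowLen (i + 1) < lam.rowLen i) :
    YoungDiagram where
  cells := lam.cells.erase (i, lam.rowLen i - 1)
  isLowerSet := by
    intro a b hba ha
    simp only [Finset.coe_erase, Set.mem_sdiff, Finset.mem_coe, YoungDiagram.mem_cells,
      Set.mem_singleton_iff] at ha ⊢
    refine ⟨lam.isLowerSet hba ha.1, fun e => ha.2 ?_⟩
    subst e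
    have h1 : a.2 < lam.rowLen a.1 := YoungDiagram.mem_iff_lt_rowLen.mp ha.1
    have h2 : i ≤ a.1 := hba.1
    have h3 : lam.rowLen i - 1 ≤ a.2 := hba.2
    have h4 : a.1 = i := by
      by_contra hne
      have := lam.rowLen_anti (i + 1) a.1 (by omega)
      omega
    rw [h4] at h1
    exact Prod.ext h4 (by simp only; omega)

theorem rowLen_removeCorner (lam : YoungDiagram) (i : ℕ)
    (h : lam.rowLen (i + 1) < lam.rowLen i) (k : ℕ) :
    (removeCorner lam i h).rowLen k = if k = i then lam.rowLen i - 1 else lam.rowLen k := by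
  have key : ∀ j, j < (removeCorner lam i h).rowLen k ↔
      j < lam.rowLen k ∧ (k, j) ≠ (i, lam.rowLen i - 1) := by
    intro j
    rw [← YoungDiagram.mem_iff_lt_rowLen, ← YoungDiagram.mem_iff_lt_rowLen,
      ← YoungDiagram.mem_cells, ← YoungDiagram.mem_cells]
    unfold removeCorner
    rw [Finset.mem_erase, and_comm]
  refine eq_of_forall_lt_iff fun j => ?_
  rw [key]
  split_ifs with hk
  · subst hk
    simp only [ne_eq, Prod.mk.injEq, true_and]
    omega
  · simp [hk]

theorem rowPoints_removeCorner {r : ℕ} (lam : YoungDiagram) {i : ℕ} (hi : i < r)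
    (h : lam.rowLen (i + 1) < lam.rowLen i) (t : ℤ) :
    rowPoints r (removeCorner lam i h) t =
      moveBack (rowPoint lam t i - 1) (rowPoints r lam t) := by
  have hp : ∀ k, rowPoint (removeCorner lam i h) t k =
      if k = i then rowPoint lam t i - 1 else rowPoint lam t k := by
    intro k
    unfold rowPoint
    rw [rowLen_removeCorner]
    split_ifs with hk
    · subst hk; omega
    · rfl
  have hinj := (rowPoint_strictAnti lam t).injective
  unfold moveBack
  rw [sub_add_cancel]
  ext x
  rw [Finset.mem_insert, Finset.mem_erase, mem_rowPoints, mem_rowPoints]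
  constructor
  · rintro ⟨k, hk, rfl⟩
    rw [hp]
    split_ifs with hki
    · exact Or.inl rfl
    · exact Or.inr ⟨fun e => hki (hinj e), k, hk, rfl⟩
  · rintro (rfl | ⟨h1, k, hk, rfl⟩)
    · exact ⟨i, hi, by rw [hp, if_pos rfl]⟩
    · exact ⟨k, hk, by rw [hp, if_neg fun e => h1 (by rw [e])]⟩

/-- The weight of a letter. -/
noncomputable def letterWeight (l : Fin N × ℤ) : ℤ × MvPolynomial (Fin N) ℤ :=
  (l.2, MvPolynomial.X l.1)

theorem amplitude_map_cons (l : Fin N × ℤ) (w : List (Fin N × ℤ)) (A B : Finset ℤ) :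
    amplitude ((l :: w).map letterWeight) A B = amplitude (w.map letterWeight) A B +
      (if l.2 + 1 ∈ B ∧ l.2 ∉ B then MvPolynomial.X l.1 else 0) *
        amplitude (w.map letterWeight) A (moveBack l.2 B) := rfl

/-- The first `i + 1` particles start at or to the right of the point of row `i` and can only move
further right. -/
theorem amplitude_eq_zero_of_card_filter_le {R : Type*} [CommRing R] (w : List (ℤ × R)) {r i : ℕ}
    (hi : i < r) {mu : YoungDiagram} {t : ℤ} {B : Finset ℤ}
    (h : (B.filter (rowPoint mu t i ≤ ·)).card ≤ i) : amplitude w (rowPoints r mu t) B = 0 := by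
  by_contra hne
  have h1 := (card_filter_le_of_amplitude_ne_zero _ _ _ hne).2 (rowPoint mu t i)
  have h2 : (Finset.range (i + 1)).image (rowPoint mu t) ⊆
      (rowPoints r mu t).filter (rowPoint mu t i ≤ ·) := by
    intro x hx
    obtain ⟨k, hk, rfl⟩ := Finset.mem_image.mp hx
    rw [Finset.mem_range] at hk
    exact Finset.mem_filter.mpr ⟨rowPoint_mem (by omega),
      (rowPoint_strictAnti mu t).antitone (by omega)⟩
  have h4 := Finset.card_le_card h2
  rw [Finset.card_image_of_injective _ (rowPoint_strictAnti mu t).injective,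
    Finset.card_range] at h4
  omega

/-- A tableau is built by adding cells in the order of entry, then content. Each cell `d` moves the
particle of its row from `shiftedContent t d` to the next integer. The head of `w` is the largest
letter, hence the last move, and the induction removes the corresponding corner. -/
theorem amplitude_rowPoints {r : ℕ} {mu : YoungDiagram} (t : ℤ) (w : List (Fin N × ℤ))
    (hw : w.Pairwise fun l l' => LetterLT l' l) :
    ∀ lam : YoungDiagram, mu ≤ lam → lam.rowLen r = 0 →
      amplitude (w.map letterWeight) (rowPoints r mu t) (rowPoints r lam t) =
        tableauSum t (lam.cells \ mu.cells) w := by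
  induction w with
  | nil =>
    intro lam hle hr
    simp only [List.map_nil, amplitude]
    rw [tableauSum_nil]
    simp only [skew_eq_empty_iff hle hr t]
  | cons l w ih =>
    intro lam hle hr
    rw [List.pairwise_cons] at hw
    have ih' := ih hw.2
    have hrow : ∀ d ∈ lam.cells \ mu.cells, d.1 < r := by
      intro d hd
      by_contra hge
      have := lam.rowLen_anti r d.1 (not_lt.mp hge)
      have := (mem_skew.mp hd).2
      omega
    have hinj := (rowPoint_strictAnti lam t).injective
    have hpt : ∀ T : ↥(lam.cells \ mu.cells) → Fin N, IsSemistandard _ T →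
        HasLettersIn t _ (l :: w) T → ∀ d, (T d, shiftedContent t d) = l →
        rowPoint lam t d.1.1 = l.2 + 1 ∧ lam.rowLen d.1.1 = d.1.2 + 1 ∧
          lam.rowLen (d.1.1 + 1) ≤ d.1.2 := by
      intro T hT hL d hd
      have h1 := corner_of_last_letter hw.1 hT hL d hd
      refine ⟨?_, h1⟩
      rw [← congrArg Prod.snd hd]
      unfold rowPoint
      rw [h1.1]
      simp only [shiftedContent]
      push_cast
      ring
    rw [amplitude_map_cons, ih' lam hle hr]
    by_cases hex : ∃ i < r, rowPoint lam t i = l.2 + 1 ∧ mu.rowLen i < lam.rowLen i ∧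
        lam.rowLen (i + 1) < lam.rowLen i
    · obtain ⟨i, hi, hp, hmu, hlt⟩ := hex
      have hcond : l.2 + 1 ∈ rowPoints r lam t ∧ l.2 ∉ rowPoints r lam t := by
        refine ⟨hp ▸ rowPoint_mem hi, fun h => ?_⟩
        obtain ⟨k, hk, hk'⟩ := mem_rowPoints.mp h
        have h1 : i < k := (rowPoint_strictAnti lam t).lt_iff_gt.mp (by omega)
        have h2 := (rowPoint_strictAnti lam t).antitone (show i + 1 ≤ k from h1)
        unfold rowPoint at *
        push_cast at *
        omega
      have hle' : mu ≤ removeCorner lam i hlt := by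
        intro d hd
        have h1 := hle hd
        rw [← YoungDiagram.mem_cells]
        refine Finset.mem_erase.mpr ⟨fun e => ?_, h1⟩
        rw [e, YoungDiagram.mem_iff_lt_rowLen] at hd
        omega
      have hr' : (removeCorner lam i hlt).rowLen r = 0 := by
        rw [rowLen_removeCorner, if_neg hi.ne', hr]
      have hmove : moveBack l.2 (rowPoints r lam t) = rowPoints r (removeCorner lam i hlt) t := by
        rw [rowPoints_removeCorner lam hi hlt, hp, add_sub_cancel_right]
      have hd : (i, lam.rowLen i - 1) ∈ lam.cells \ mu.cells := mem_skew.mpr ⟨by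
        simp only; omega, by simp only; omega⟩
      have hcells : (removeCorner lam i hlt).cells \ mu.cells =
          (lam.cells \ mu.cells).erase (i, lam.rowLen i - 1) := by
        unfold removeCorner
        rw [Finset.erase_sdiff_comm]
      have hcor := tableauSum_cons_of_corner (t := t) hw.1 hd ?_ ?_ ?_ ?_
      · rw [if_pos hcond, hmove, ih' _ hle' hr', hcor, hcells]
      · unfold rowPoint at hp
        simp only [shiftedContent]
        omega
      · intro e he hei
        have := (mem_skew.mp he).2
        rw [hei] at this
        simp only at this ⊢
        omega
      · intro e he hei
        by_contra hgt
        have h1 := (mem_skew.mp he).2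
        have h2 := lam.rowLen_anti (i + 1) e.1 (not_le.mp hgt)
        simp only at hei
        omega
      · intro T hT hL e he
        obtain ⟨h1, h2, -⟩ := hpt T hT hL e he
        have h3 : e.1.1 = i := hinj (h1.trans hp.symm)
        refine Prod.ext h3 ?_
        rw [h3] at h2
        simp only
        omega
    · have hunused : tableauSum t (lam.cells \ mu.cells) (l :: w) =
          tableauSum t (lam.cells \ mu.cells) w := by
        refine tableauSum_cons_of_unused fun T hT hL d hd => hex ?_
        obtain ⟨h1, h2, h3⟩ := hpt T hT hL d hd
        have h4 := (mem_skew.mp d.2).1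
        exact ⟨d.1.1, hrow d d.2, h1, by omega, by omega⟩
      rw [hunused]
      by_cases hcond : l.2 + 1 ∈ rowPoints r lam t ∧ l.2 ∉ rowPoints r lam t
      · obtain ⟨i, hi, hp⟩ := mem_rowPoints.mp hcond.1
        -- The hop is possible for the particles of `lam`, but the row has no cell outside `mu`.
        -- Undoing it would put the particle to the left of its starting point.
        suffices h0 : amplitude (w.map letterWeight) (rowPoints r mu t)
            (moveBack l.2 (rowPoints r lam t)) = 0 by
          rw [h0, mul_zero, add_zero]
        have hml := rowLen_le_of_le hle i
        have hmu : mu.rowLen i = lam.rowLen i := by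
          by_contra hne
          refine hex ⟨i, hi, hp, lt_of_le_of_ne hml hne, ?_⟩
          by_contra hge
          have he : lam.rowLen (i + 1) = lam.rowLen i :=
            le_antisymm (lam.rowLen_anti i (i + 1) (Nat.le_succ i)) (not_lt.mp hge)
          by_cases hir : i + 1 < r
          · refine hcond.2 (mem_rowPoints.mpr ⟨i + 1, hir, ?_⟩)
            unfold rowPoint at *
            push_cast
            omega
          · obtain rfl : i + 1 = r := by omega
            omega
        have hmp : rowPoint mu t i = l.2 + 1 := by
          rw [← hp, rowPoint, hmu, rowPoint]
        refine amplitude_eq_zero_of_card_filter_le _ hi ?_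
        have h3 : (moveBack l.2 (rowPoints r lam t)).filter (rowPoint mu t i ≤ ·) ⊆
            (Finset.range i).image (rowPoint lam t) := by
          intro x hx
          rw [hmp, Finset.mem_filter, moveBack, Finset.mem_insert, Finset.mem_erase,
            mem_rowPoints] at hx
          obtain ⟨rfl | ⟨hne, k, hk, rfl⟩, h4⟩ := hx
          · omega
          · refine Finset.mem_image_of_mem _ (Finset.mem_range.mpr ?_)
            exact (rowPoint_strictAnti lam t).lt_iff_gt.mp (by omega)
        exact (Finset.card_le_card h3).trans (Finset.card_image_le.trans_eq (Finset.card_range i))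
      · rw [if_neg hcond, zero_mul, add_zero]

end Tableaux

end BicolouredPaths

namespace BicolouredPaths

/-! ### Skew Schur functions of point sets as amplitudes. -/

section PointsSchur

/-- All letters with contents in `V`, the largest first. -/
def letterWord (N : ℕ) (V : Finset ℤ) : List (Fin N × ℤ) :=
  (Finset.sort (((Finset.univ : Finset (Fin N)) ×ˢ V).map toLex.toEmbedding) (· ≥ ·)).map ofLex

theorem mem_letterWord {N : ℕ} {V : Finset ℤ} {l : Fin N × ℤ} :
    l ∈ letterWord N V ↔ l.2 ∈ V := by
  unfold letterWord
  rw [List.mem_map]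
  constructor
  · rintro ⟨a, ha, rfl⟩
    rw [Finset.mem_sort, Finset.mem_map] at ha
    obtain ⟨b, hb, rfl⟩ := ha
    exact (Finset.mem_product.mp hb).2
  · intro h
    exact ⟨toLex l, (Finset.mem_sort _).mpr (Finset.mem_map_of_mem _
      (Finset.mem_product.mpr ⟨Finset.mem_univ _, h⟩)), rfl⟩

theorem pairwise_letterWord (N : ℕ) (V : Finset ℤ) :
    (letterWord N V).Pairwise fun l l' => LetterLT l' l := by
  unfold letterWord
  rw [List.pairwise_map]
  refine (Finset.sortedGT_sort _).pairwise.imp fun {a b} h => ?_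
  exact Prod.Lex.lt_iff.mp h

/-- The generating function of the particle motions from `A` to `B` within `[a, b]`. -/
noncomputable def schurAmplitude (N : ℕ) (a b : ℤ) (A B : Finset ℤ) : MvPolynomial (Fin N) ℤ :=
  amplitude ((letterWord N (Finset.Ico a b)).map letterWeight) A B

/-- The shifted contents in a row run from its starting point to one less than its ending point, so
the letters with contents in `[a, b)` suffice. -/
theorem skewSchur_eq_schurAmplitude {N r : ℕ} {lam mu : YoungDiagram} (hle : mu ≤ lam)
    (hr : lam.rowLen r = 0) {t a b : ℤ} (hmu : ∀ x ∈ rowPoints r mu t, a ≤ x)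
    (hlam : ∀ x ∈ rowPoints r lam t, x ≤ b) :
    skewSchur N lam mu = schurAmplitude N a b (rowPoints r mu t) (rowPoints r lam t) := by
  unfold schurAmplitude
  rw [amplitude_rowPoints t _ (pairwise_letterWord N _) lam hle hr]
  refine skewSchur_eq_tableauSum t _ fun k d hd => ?_
  rw [mem_letterWord, Finset.mem_Ico]
  rw [mem_skew] at hd
  have hi : d.1 < r := by
    by_contra hge
    have := lam.rowLen_anti r d.1 (not_lt.mp hge)
    omega
  have h1 := hmu _ (rowPoint_mem hi)
  have h2 := hlam _ (rowPoint_mem hi)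
  unfold rowPoint at h1 h2
  simp only [shiftedContent]
  omega

theorem nthLargest_strictAnti {r : ℕ} (E : Finset ℤ) (h : E.card = r) :
    StrictAnti (nthLargest E h) := fun _ _ hij =>
  (E.orderEmbOfFin h).strictMono (Fin.rev_lt_rev.mpr hij)

theorem nthLargest_mem {r : ℕ} (E : Finset ℤ) (h : E.card = r) (i : Fin r) :
    nthLargest E h i ∈ E := Finset.orderEmbOfFin_mem _ _ _

theorem exists_nthLargest {r : ℕ} {E : Finset ℤ} (h : E.card = r) {x : ℤ} (hx : x ∈ E) :
    ∃ i, nthLargest E h i = x := by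
  rw [← Finset.mem_coe, ← Finset.range_orderEmbOfFin E h] at hx
  obtain ⟨j, hj⟩ := hx
  exact ⟨j.rev, by rw [nthLargest, Fin.rev_rev, hj]⟩

theorem add_le_nthLargest {r : ℕ} (E : Finset ℤ) (h : E.card = r) {a : ℤ} (ha : ∀ x ∈ E, a ≤ x)
    (k : ℕ) (i : Fin r) (hik : (i : ℕ) + k + 1 = r) : a + k ≤ nthLargest E h i := by
  induction k generalizing i with
  | zero => simpa using ha _ (nthLargest_mem E h i)
  | succ k ih =>
    have h1 : (i : ℕ) + 1 < r := by omega
    have h2 := ih ⟨i + 1, h1⟩ (by simp only; omega)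
    have h3 : nthLargest E h ⟨i + 1, h1⟩ < nthLargest E h i :=
      nthLargest_strictAnti E h (Fin.lt_def.mpr (Nat.lt_succ_self _))
    push_cast
    omega

theorem untopD_min_le {E : Finset ℤ} {x : ℤ} (hx : x ∈ E) : E.min.untopD 0 ≤ x := by
  obtain ⟨m, hm⟩ := Finset.min_of_mem hx
  rw [hm]
  exact Finset.min_le_of_eq hx hm

theorem rowLen_pointPartition {r : ℕ} (E : Finset ℤ) (h : E.card = r) (t : ℤ) (i : Fin r) :
    (pointPartition E h t).rowLen i = (nthLargest E h i + ((i : ℕ) + 1) - t).toNat := by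
  have := YoungDiagram.rowLen_ofRowLens (hw := (pointRows_antitone E h t).sortedGE_ofFn)
    (i.cast (List.length_ofFn).symm)
  unfold pointPartition
  simpa using this

theorem rowLen_pointPartition_self {r : ℕ} (E : Finset ℤ) (h : E.card = r) (t : ℤ) :
    (pointPartition E h t).rowLen r = 0 := by
  by_contra hne
  have h1 : (r, 0) ∈ pointPartition E h t :=
    YoungDiagram.mem_iff_lt_rowLen.mpr (Nat.pos_of_ne_zero hne)
  unfold pointPartition at h1
  rw [YoungDiagram.mem_ofRowLens] at h1
  obtain ⟨h2, -⟩ := h1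
  simp at h2

theorem rowPoints_pointPartition {r : ℕ} (E : Finset ℤ) (h : E.card = r) (t : ℤ)
    (hpos : ∀ i, 0 ≤ nthLargest E h i + ((i : ℕ) + 1) - t) :
    rowPoints r (pointPartition E h t) t = E := by
  have hp : ∀ i : Fin r, rowPoint (pointPartition E h t) t i = nthLargest E h i := fun i => by
    unfold rowPoint
    rw [rowLen_pointPartition, Int.toNat_of_nonneg (hpos i)]
    ring
  ext x
  rw [mem_rowPoints]
  constructor
  · rintro ⟨i, hi, rfl⟩
    rw [hp ⟨i, hi⟩]
    exact nthLargest_mem _ _ _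
  · intro hx
    obtain ⟨i, rfl⟩ := exists_nthLargest h hx
    exact ⟨i, i.2, hp i⟩

/-- Failure at index `i` would leave at least `i + 1` points of `A`, but at most `i` of `B`, at or
to the right of the `i`-th point of `A`, counting from `0`. -/
theorem nthLargest_le_of_amplitude_ne_zero {R : Type*} [CommRing R] {w : List (ℤ × R)}
    {A B : Finset ℤ} {r : ℕ} (hA : A.card = r) (hB : B.card = r) (h : amplitude w A B ≠ 0)
    (i : Fin r) : nthLargest A hA i ≤ nthLargest B hB i := by
  by_contra hlt
  rw [not_le] at hlt
  have h1 := (card_filter_le_of_amplitude_ne_zero w A B h).2 (nthLargest A hA i)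
  have h2 : (Finset.Iic i).image (nthLargest A hA) ⊆ A.filter (nthLargest A hA i ≤ ·) := by
    intro x hx
    obtain ⟨k, hk, rfl⟩ := Finset.mem_image.mp hx
    exact Finset.mem_filter.mpr ⟨nthLargest_mem _ _ _,
      (nthLargest_strictAnti A hA).antitone (Finset.mem_Iic.mp hk)⟩
  have h3 : B.filter (nthLargest A hA i ≤ ·) ⊆ (Finset.Iio i).image (nthLargest B hB) := by
    intro x hx
    obtain ⟨hx, hx'⟩ := Finset.mem_filter.mp hx
    obtain ⟨k, rfl⟩ := exists_nthLargest hB hx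
    refine Finset.mem_image_of_mem _ (Finset.mem_Iio.mpr ?_)
    exact (nthLargest_strictAnti B hB).lt_iff_gt.mp (hlt.trans_le hx')
  have h4 := Finset.card_le_card h2
  have h5 := (Finset.card_le_card h3).trans Finset.card_image_le
  rw [Finset.card_image_of_injective _ (nthLargest_strictAnti A hA).injective,
    Fin.card_Iic] at h4
  rw [Fin.card_Iio] at h5
  omega

theorem pointPartition_mono {r : ℕ} {A B : Finset ℤ} (hA : A.card = r) (hB : B.card = r) (t : ℤ)
    (h : ∀ i, nthLargest A hA i ≤ nthLargest B hB i) :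
    pointPartition A hA t ≤ pointPartition B hB t := by
  have key : ∀ i, (pointPartition A hA t).rowLen i ≤ (pointPartition B hB t).rowLen i := by
    intro i
    by_cases hi : i < r
    · have h1 := rowLen_pointPartition A hA t ⟨i, hi⟩
      have h2 := rowLen_pointPartition B hB t ⟨i, hi⟩
      simp only at h1 h2
      rw [h1, h2]
      have := h ⟨i, hi⟩
      exact Int.toNat_le_toNat (by omega)
    · have h1 := (pointPartition A hA t).rowLen_anti r i (not_lt.mp hi)
      rw [rowLen_pointPartition_self] at h1
      omega
  intro d hd
  change d ∈ pointPartition A hA t at hd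
  rw [← Prod.mk.eta (p := d), YoungDiagram.mem_iff_lt_rowLen] at hd ⊢
  exact hd.trans_le (key _)

/-- The zero conventions need no separate treatment later: the amplitude itself vanishes when the
numbers of points differ or an ending point lies to the left of its starting point. -/
theorem pointsSchur_eq_schurAmplitude (N : ℕ) {F : Finset BPoint} {a b : ℤ}
    (ha : ∀ x ∈ startXs F, a ≤ x) (hb : ∀ x ∈ endXs F, x ≤ b) :
    pointsSchur N F = schurAmplitude N a b (startXs F) (endXs F) := by
  unfold pointsSchur
  split_ifs with h1 h2
  · set t := (startXs F).min.untopD 0 + (startXs F).card with ht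
    -- With this shift the last inner row is exactly zero. Distinct integers grow by at least one
    -- per step, so the truncation in `pointPartition` loses nothing.
    have hs : ∀ i, 0 ≤ nthLargest (startXs F) rfl i + ((i : ℕ) + 1) - t := by
      intro i
      have hi := i.2
      have := add_le_nthLargest (startXs F) rfl (fun x hx => untopD_min_le hx)
        ((startXs F).card - 1 - i) i (by omega)
      omega
    have hA := rowPoints_pointPartition (startXs F) rfl t hs
    have hB := rowPoints_pointPartition (endXs F) h1 t fun i => by
      have := hs i
      have := h2 i
      omega
    rw [skewSchur_eq_schurAmplitude (a := a) (b := b) (t := t)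
      (pointPartition_mono rfl h1 t h2) (rowLen_pointPartition_self _ _ _) (by rwa [hA])
      (by rwa [hB]), hA, hB]
  · by_contra hne
    exact h2 (nthLargest_le_of_amplitude_ne_zero rfl h1 (Ne.symm hne))
  · by_contra hne
    exact h1 (card_filter_le_of_amplitude_ne_zero _ _ _ (Ne.symm hne)).1.symm

end PointsSchur

end BicolouredPaths

namespace BicolouredPaths

/-! ### The circular order of the points and its signs. -/

section Points

theorem isEnd_endPt (x : ℤ) : IsEnd (endPt x) := rfl

theorem not_isEnd_startPt (x : ℤ) : ¬ IsEnd (startPt x) := Bool.false_ne_true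

theorem endPt_or_startPt (p : BPoint) : (∃ x, p = endPt x) ∨ ∃ x, p = startPt x := by
  rcases h : ofLex p with x | x
  · exact Or.inl ⟨OrderDual.ofDual x, congrArg toLex h⟩
  · exact Or.inr ⟨x, congrArg toLex h⟩

theorem endPt_injective : Function.Injective endPt := fun _ _ h => congrArg xCoord h

theorem startPt_injective : Function.Injective startPt := fun _ _ h => congrArg xCoord h

theorem endPt_ne_startPt (x y : ℤ) : endPt x ≠ startPt y := fun h =>
  not_isEnd_startPt y (h ▸ isEnd_endPt x)

theorem endPt_lt_startPt (x y : ℤ) : endPt x < startPt y := Sum.Lex.inl_lt_inr _ _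

theorem endPt_lt_endPt {x y : ℤ} : endPt x < endPt y ↔ y < x := Sum.Lex.inl_lt_inl_iff

theorem startPt_lt_startPt {x y : ℤ} : startPt x < startPt y ↔ x < y := Sum.Lex.inr_lt_inr_iff

theorem mem_endXs {F : Finset BPoint} {x : ℤ} : x ∈ endXs F ↔ endPt x ∈ F := by
  unfold endXs
  rw [Finset.mem_image]
  constructor
  · rintro ⟨p, hp, rfl⟩
    rw [Finset.mem_filter] at hp
    rcases endPt_or_startPt p with ⟨y, rfl⟩ | ⟨y, rfl⟩
    · exact hp.1
    · exact absurd hp.2 (not_isEnd_startPt y)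
  · exact fun h => ⟨_, Finset.mem_filter.mpr ⟨h, isEnd_endPt x⟩, rfl⟩

theorem mem_startXs {F : Finset BPoint} {x : ℤ} : x ∈ startXs F ↔ startPt x ∈ F := by
  unfold startXs
  rw [Finset.mem_image]
  constructor
  · rintro ⟨p, hp, rfl⟩
    rw [Finset.mem_filter] at hp
    rcases endPt_or_startPt p with ⟨y, rfl⟩ | ⟨y, rfl⟩
    · exact absurd (isEnd_endPt y) hp.2
    · exact hp.1
  · exact fun h => ⟨_, Finset.mem_filter.mpr ⟨h, not_isEnd_startPt x⟩, rfl⟩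

theorem eq_image_union_image (F : Finset BPoint) :
    F = (endXs F).image endPt ∪ (startXs F).image startPt := by
  ext p
  simp only [Finset.mem_union, Finset.mem_image, mem_endXs, mem_startXs]
  constructor
  · intro hp
    rcases endPt_or_startPt p with ⟨x, rfl⟩ | ⟨x, rfl⟩
    · exact Or.inl ⟨x, hp, rfl⟩
    · exact Or.inr ⟨x, hp, rfl⟩
  · rintro (⟨x, hx, rfl⟩ | ⟨x, hx, rfl⟩) <;> exact hx

theorem sum_points {M : Type*} [AddCommMonoid M] (F : Finset BPoint) (f : BPoint → M) :
    ∑ p ∈ F, f p = ∑ x ∈ endXs F, f (endPt x) + ∑ x ∈ startXs F, f (startPt x) := by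
  conv_lhs => rw [eq_image_union_image F]
  rw [Finset.sum_union, Finset.sum_image endPt_injective.injOn,
    Finset.sum_image startPt_injective.injOn]
  rw [Finset.disjoint_left]
  intro p h1 h2
  obtain ⟨x, -, rfl⟩ := Finset.mem_image.mp h1
  obtain ⟨y, -, h⟩ := Finset.mem_image.mp h2
  exact endPt_ne_startPt x y h.symm

theorem card_points (F : Finset BPoint) : F.card = (endXs F).card + (startXs F).card := by
  simpa only [Finset.card_eq_sum_ones] using sum_points F fun _ => (1 : ℕ)

theorem endXs_filter_lt_endPt (F : Finset BPoint) (x : ℤ) :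
    endXs (F.filter (· < endPt x)) = (endXs F).filter (x < ·) := by
  ext y; simp [mem_endXs, endPt_lt_endPt]

theorem startXs_filter_lt_endPt (F : Finset BPoint) (x : ℤ) :
    startXs (F.filter (· < endPt x)) = ∅ := by
  ext y; simp [mem_startXs, (endPt_lt_startPt x y).le]

theorem endXs_filter_lt_startPt (F : Finset BPoint) (x : ℤ) :
    endXs (F.filter (· < startPt x)) = endXs F := by
  ext y; simp [mem_endXs, endPt_lt_startPt]

theorem startXs_filter_lt_startPt (F : Finset BPoint) (x : ℤ) :
    startXs (F.filter (· < startPt x)) = (startXs F).filter (· < x) := by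
  ext y; simp [mem_startXs, startPt_lt_startPt]

variable {R : Type*} [CommRing R]

theorem sign_startPt (F : Finset BPoint) (x : ℤ) :
    ((-1) ^ (F.filter (· < startPt x)).card : R) =
      (-1) ^ (endXs F).card * leftSign R (startXs F) x := by
  rw [card_points, endXs_filter_lt_startPt, startXs_filter_lt_startPt, pow_add]
  rfl

theorem leftSign_mul_self (B : Finset ℤ) (q : ℤ) : leftSign R B q * leftSign R B q = 1 := by
  unfold leftSign
  rw [← mul_pow]
  simp

theorem leftSign_union {X Y : Finset ℤ} (h : Disjoint X Y) (q : ℤ) :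
    leftSign R (X ∪ Y) q = leftSign R X q * leftSign R Y q := by
  unfold leftSign
  rw [Finset.filter_union, Finset.card_union_of_disjoint (Finset.disjoint_filter_filter h), pow_add]

/-- Ending points are listed from right to left, so those before `x` are all ending points except
`x` and those to its left. The excluded `x` gives the extra minus sign, which later puts the two
sides of the bilinear relation on one side of an equation. -/
theorem sign_endPt {F : Finset BPoint} {x : ℤ} (hx : x ∈ endXs F) :
    ((-1) ^ (F.filter (· < endPt x)).card : R) =
      -((-1) ^ (endXs F).card * leftSign R (endXs F) x) := by
  rw [card_points, endXs_filter_lt_endPt, startXs_filter_lt_endPt, Finset.card_empty, add_zero]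
  have h1 : (endXs F).card =
      ((endXs F).filter (x < ·)).card + ((endXs F).filter (· < x)).card + 1 := by
    rw [← Finset.card_filter_add_card_filter_not (s := endXs F) (x < ·), add_assoc]
    congr 1
    have : (endXs F).filter (fun y => ¬ x < y) = insert x ((endXs F).filter (· < x)) := by
      ext y
      simp only [Finset.mem_filter, Finset.mem_insert, not_lt]
      constructor
      · rintro ⟨h1, h2⟩
        rcases h2.eq_or_lt with h | h
        · exact Or.inl h
        · exact Or.inr ⟨h1, h⟩
      · rintro (rfl | ⟨h1, h2⟩)
        · exact ⟨hx, le_rfl⟩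
        · exact ⟨h1, h2.le⟩
    rw [this, Finset.card_insert_of_notMem (by simp)]
  have h2 := leftSign_mul_self (R := R) (endXs F) x
  unfold leftSign at h2 ⊢
  rw [h1, pow_add, pow_add, mul_assoc, mul_assoc]
  linear_combination (-(-1) ^ ((endXs F).filter (x < ·)).card : R) * h2

end Points

/-! ### The orientation function is killed by the raising operator. -/

section Orientations

variable (K : Placement)

/-- The product of the two generating functions belonging to an orientation. -/
noncomputable def orientationAmplitude (N : ℕ) (a b : ℤ) (I : Finset BPoint) :
    MvPolynomial (Fin N) ℤ :=
  schurAmplitude N a b (startXs (K.reorient I).white) (endXs (K.reorient I).white) *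
    schurAmplitude N a b (startXs (K.reorient I).black) (endXs (K.reorient I).black)

variable {K}

theorem notMem_coloured_of_mem_inter {p : BPoint} (h : p ∈ K.white ∩ K.black) :
    p ∉ K.coloured := by
  rw [Finset.mem_inter] at h
  simp [Placement.coloured, Finset.mem_symmDiff, h.1, h.2]

theorem startXs_reorient_white (I : Finset BPoint) :
    startXs (K.reorient I).white = startXs (K.white ∩ K.black) ∪ startXs (K.coloured \ I) := by
  ext x
  simp [mem_startXs, Placement.reorient, not_isEnd_startPt]

theorem endXs_reorient_white {I : Finset BPoint} (hI : I ⊆ K.coloured) :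
    endXs (K.reorient I).white = endXs (K.white ∩ K.black) ∪ endXs I := by
  ext x
  have := @hI (endPt x)
  simp only [mem_endXs, Placement.reorient, Finset.mem_union, Finset.mem_filter, isEnd_endPt,
    iff_true]
  tauto

theorem startXs_reorient_black {I : Finset BPoint} (hI : I ⊆ K.coloured) :
    startXs (K.reorient I).black = startXs (K.white ∩ K.black) ∪ startXs I := by
  ext x
  have := @hI (startPt x)
  simp only [mem_startXs, Placement.reorient, Finset.mem_union, Finset.mem_filter,
    not_isEnd_startPt, iff_false, not_not]
  tauto

theorem endXs_reorient_black (I : Finset BPoint) :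
    endXs (K.reorient I).black = endXs (K.white ∩ K.black) ∪ endXs (K.coloured \ I) := by
  ext x
  simp [mem_endXs, Placement.reorient, isEnd_endPt]

theorem disjoint_startXs {F : Finset BPoint} (hF : F ⊆ K.coloured) :
    Disjoint (startXs (K.white ∩ K.black)) (startXs F) := by
  rw [Finset.disjoint_left]
  intro x h1 h2
  exact notMem_coloured_of_mem_inter (mem_startXs.mp h1) (hF (mem_startXs.mp h2))

theorem disjoint_endXs {F : Finset BPoint} (hF : F ⊆ K.coloured) :
    Disjoint (endXs (K.white ∩ K.black)) (endXs F) := by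
  rw [Finset.disjoint_left]
  intro x h1 h2
  exact notMem_coloured_of_mem_inter (mem_endXs.mp h1) (hF (mem_endXs.mp h2))

theorem startXs_sdiff_union {F I : Finset BPoint} (hI : I ⊆ F) :
    startXs F = startXs (F \ I) ∪ startXs I := by
  ext x
  have := @hI (startPt x)
  simp only [mem_startXs, Finset.mem_union, Finset.mem_sdiff]
  tauto

theorem endXs_sdiff_union {F I : Finset BPoint} (hI : I ⊆ F) :
    endXs F = endXs (F \ I) ∪ endXs I := by
  ext x
  have := @hI (endPt x)
  simp only [mem_endXs, Finset.mem_union, Finset.mem_sdiff]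
  tauto

theorem disjoint_startXs_sdiff (F I : Finset BPoint) :
    Disjoint (startXs (F \ I)) (startXs I) := by
  rw [Finset.disjoint_left]
  intro x h1 h2
  exact (Finset.mem_sdiff.mp (mem_startXs.mp h1)).2 (mem_startXs.mp h2)

theorem disjoint_endXs_sdiff (F I : Finset BPoint) :
    Disjoint (endXs (F \ I)) (endXs I) := by
  rw [Finset.disjoint_left]
  intro x h1 h2
  exact (Finset.mem_sdiff.mp (mem_endXs.mp h1)).2 (mem_endXs.mp h2)

/-- Each colour must have as many starting as ending points. The doubly coloured points cancel, and
adding the two equations gives as many inward as outward points. -/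
theorem card_coloured_of_orientationAmplitude_ne_zero {N : ℕ} {a b : ℤ} {I : Finset BPoint}
    (hI : I ⊆ K.coloured) (h : orientationAmplitude K N a b I ≠ 0) :
    K.coloured.card = 2 * I.card := by
  have h1 := (card_filter_le_of_amplitude_ne_zero _ _ _ (left_ne_zero_of_mul h)).1
  have h2 := (card_filter_le_of_amplitude_ne_zero _ _ _ (right_ne_zero_of_mul h)).1
  rw [startXs_reorient_white, endXs_reorient_white hI,
    Finset.card_union_of_disjoint (disjoint_startXs Finset.sdiff_subset),
    Finset.card_union_of_disjoint (disjoint_endXs hI)] at h1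
  rw [startXs_reorient_black hI, endXs_reorient_black,
    Finset.card_union_of_disjoint (disjoint_startXs hI),
    Finset.card_union_of_disjoint (disjoint_endXs Finset.sdiff_subset)] at h2
  have h3 := card_points (K.coloured \ I)
  have h4 := card_points I
  have h5 := Finset.card_sdiff_add_card_eq_card hI
  omega

/-- Turning an outward starting point inward moves it from white (`A`) to black (`A'`); turning an
outward ending point inward moves it from black (`B'`) to white (`B`). These are the two sides of
`sum_amplitude_mul_amplitude`. -/
theorem raising_orientationAmplitude {N : ℕ} {a b : ℤ} {I : Finset BPoint}
    (hI : I ⊆ K.coloured) : raising K.coloured (orientationAmplitude K N a b) I = 0 := by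
  set P := K.coloured with hP
  set D := K.white ∩ K.black with hD
  set A := startXs D ∪ startXs (P \ I) with hA
  set A' := startXs D ∪ startXs I with hA'
  set B := endXs D ∪ endXs I with hB
  set B' := endXs D ∪ endXs (P \ I) with hB'
  have hDs : Disjoint (startXs D) (startXs P) := disjoint_startXs subset_rfl
  have hDe : Disjoint (endXs D) (endXs P) := disjoint_endXs subset_rfl
  have hPI : P \ I ⊆ P := Finset.sdiff_subset
  -- Doubly coloured points occur in both sets, so their signs square to one.
  have hsA : ∀ x, leftSign (MvPolynomial (Fin N) ℤ) (startXs P) x =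
      leftSign _ A x * leftSign _ A' x := by
    intro x
    have h1 := leftSign_mul_self (R := MvPolynomial (Fin N) ℤ) (startXs D) x
    rw [startXs_sdiff_union hI, leftSign_union (disjoint_startXs_sdiff P I),
      leftSign_union (disjoint_startXs hPI), leftSign_union (disjoint_startXs hI)]
    linear_combination (-(leftSign (MvPolynomial (Fin N) ℤ) (startXs (P \ I)) x *
      leftSign _ (startXs I) x)) * h1
  have hsB : ∀ x, leftSign (MvPolynomial (Fin N) ℤ) (endXs P) x =
      leftSign _ B x * leftSign _ B' x := by
    intro x
    have h1 := leftSign_mul_self (R := MvPolynomial (Fin N) ℤ) (endXs D) x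
    rw [endXs_sdiff_union hI, leftSign_union (disjoint_endXs_sdiff P I),
      leftSign_union (disjoint_endXs hPI), leftSign_union (disjoint_endXs hI)]
    linear_combination (-(leftSign (MvPolynomial (Fin N) ℤ) (endXs (P \ I)) x *
      leftSign _ (endXs I) x)) * h1
  have hstart : ∀ x ∈ startXs (P \ I), orientationAmplitude K N a b (insert (startPt x) I) =
      schurAmplitude N a b (A.erase x) B * schurAmplitude N a b (insert x A') B' := by
    intro x hx
    have hx' := mem_startXs.mp hx
    have hxP := (Finset.mem_sdiff.mp hx').1
    have hI' : insert (startPt x) I ⊆ P := Finset.insert_subset hxP hI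
    have hxD : startPt x ∉ D := fun h => notMem_coloured_of_mem_inter h hxP
    unfold orientationAmplitude
    rw [startXs_reorient_white, endXs_reorient_white hI', startXs_reorient_black hI',
      endXs_reorient_black]
    congr 2
    · ext y
      simp only [hA, Finset.mem_union, Finset.mem_erase, mem_startXs, Finset.mem_sdiff,
        Finset.mem_insert, startPt_injective.eq_iff]
      by_cases hyx : y = x
      · subst hyx; simp [← hD, hxD]
      · simp [hyx, ← hD, ← hP]
    · ext y
      simp [hB, mem_endXs, endPt_ne_startPt, ← hD]
    · ext y
      simp only [hA', Finset.mem_union, Finset.mem_insert, mem_startXs,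
        startPt_injective.eq_iff, ← hD]
      tauto
    · ext y
      simp [hB', mem_endXs, endPt_ne_startPt, ← hD, ← hP]
  have hend : ∀ x ∈ endXs (P \ I), orientationAmplitude K N a b (insert (endPt x) I) =
      schurAmplitude N a b A (insert x B) * schurAmplitude N a b A' (B'.erase x) := by
    intro x hx
    have hx' := mem_endXs.mp hx
    have hxP := (Finset.mem_sdiff.mp hx').1
    have hI' : insert (endPt x) I ⊆ P := Finset.insert_subset hxP hI
    have hxD : endPt x ∉ D := fun h => notMem_coloured_of_mem_inter h hxP
    unfold orientationAmplitude
    rw [startXs_reorient_white, endXs_reorient_white hI', startXs_reorient_black hI',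
      endXs_reorient_black]
    congr 2
    · ext y
      simp [hA, mem_startXs, (endPt_ne_startPt _ _).symm, ← hD, ← hP]
    · ext y
      simp only [hB, Finset.mem_union, Finset.mem_insert, mem_endXs,
        endPt_injective.eq_iff, ← hD]
      tauto
    · ext y
      simp [hA', mem_startXs, (endPt_ne_startPt _ _).symm, ← hD]
    · ext y
      simp only [hB', Finset.mem_union, Finset.mem_erase, mem_endXs, Finset.mem_sdiff,
        Finset.mem_insert, endPt_injective.eq_iff]
      by_cases hyx : y = x
      · subst hyx; simp [← hD, hxD]
      · simp [hyx, ← hD, ← hP]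
  have hmemA : ∀ x, x ∈ A ∧ x ∉ A' ↔ x ∈ startXs (P \ I) := by
    intro x
    have h1 : x ∈ startXs D → x ∉ startXs P := fun h => Finset.disjoint_left.mp hDs h
    simp only [hA, hA', Finset.mem_union, mem_startXs, Finset.mem_sdiff] at h1 ⊢
    tauto
  have hmemB : ∀ x, x ∉ B ∧ x ∈ B' ↔ x ∈ endXs (P \ I) := by
    intro x
    have h1 : x ∈ endXs D → x ∉ endXs P := fun h => Finset.disjoint_left.mp hDe h
    simp only [hB, hB', Finset.mem_union, mem_endXs, Finset.mem_sdiff] at h1 ⊢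
    tauto
  -- The index set must contain both ends of every possible move and all points that may change
  -- colour; the remaining terms are zero.
  set U := Finset.Icc a b ∪ (startXs (P \ I) ∪ endXs (P \ I)) with hU
  have hrel := sum_amplitude_mul_amplitude (U := U)
    ((letterWord N (Finset.Ico a b)).map letterWeight) (fun l hl => by
      obtain ⟨l, hl', rfl⟩ := List.mem_map.mp hl
      have h1 := Finset.mem_Ico.mp (mem_letterWord.mp hl')
      refine ⟨Finset.mem_union_left _ (Finset.mem_Icc.mpr ?_),
        Finset.mem_union_left _ (Finset.mem_Icc.mpr ?_)⟩ <;> simp only [letterWeight] <;> omega)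
    A A' B B'
  have hL : ∑ p ∈ U, (if p ∈ A ∧ p ∉ A' then leftSign (MvPolynomial (Fin N) ℤ) A p *
        leftSign _ A' p else 0) *
        (schurAmplitude N a b (A.erase p) B * schurAmplitude N a b (insert p A') B') =
      ∑ x ∈ startXs (P \ I), leftSign _ (startXs P) x *
        orientationAmplitude K N a b (insert (startPt x) I) := by
    rw [← Finset.sum_subset (s₁ := startXs (P \ I))
      (Finset.subset_union_left.trans Finset.subset_union_right)]
    · refine Finset.sum_congr rfl fun x hx => ?_
      rw [if_pos ((hmemA x).mpr hx), hstart x hx, hsA]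
    · intro x _ hx
      rw [if_neg fun h => hx ((hmemA x).mp h), zero_mul]
  have hR : ∑ q ∈ U, addOp q (schurAmplitude N a b A) B *
        removeOp q (schurAmplitude N a b A') B' =
      ∑ x ∈ endXs (P \ I), leftSign _ (endXs P) x *
        orientationAmplitude K N a b (insert (endPt x) I) := by
    rw [← Finset.sum_subset (s₁ := endXs (P \ I))
      (Finset.subset_union_right.trans Finset.subset_union_right)]
    · refine Finset.sum_congr rfl fun x hx => ?_
      have h1 := (hmemB x).mpr hx
      rw [addOp, removeOp, if_pos h1.1, if_pos h1.2, hend x hx, hsB]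
      ring
    · intro x _ hx
      rw [addOp, removeOp]
      by_cases h1 : x ∈ B
      · rw [if_neg (not_not.mpr h1), zero_mul]
      · rw [if_neg fun h2 => hx ((hmemB x).mp ⟨h1, h2⟩), mul_zero]
  have hLR := (hL.symm.trans hrel).trans hR
  unfold raising
  rw [sum_points]
  have h1 : ∀ x ∈ endXs (P \ I), (-1) ^ (P.filter (· < endPt x)).card *
      orientationAmplitude K N a b (insert (endPt x) I) = -(-1) ^ (endXs P).card *
      (leftSign _ (endXs P) x * orientationAmplitude K N a b (insert (endPt x) I)) := by
    intro x hx
    have hxP : x ∈ endXs P := mem_endXs.mpr (hPI (mem_endXs.mp hx))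
    rw [sign_endPt hxP]
    ring
  have h2 : ∀ x ∈ startXs (P \ I), (-1) ^ (P.filter (· < startPt x)).card *
      orientationAmplitude K N a b (insert (startPt x) I) = (-1) ^ (endXs P).card *
      (leftSign _ (startXs P) x * orientationAmplitude K N a b (insert (startPt x) I)) := by
    intro x _
    rw [sign_startPt]
    ring
  have h3 := congrArg₂ (· + ·) (Finset.sum_congr rfl h1) (Finset.sum_congr rfl h2)
  simp only [neg_mul, Finset.sum_neg_distrib, ← Finset.mul_sum, hLR, neg_add_cancel] at h3
  convert h3

end Orientations

/-! ### Evaluating one matching on the orientations in `Q`. -/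

section Counting

theorem iff_not_of_even_card_between {α : Type*} [LinearOrder α] {P : Finset α} {c : α → Prop}
    (h : ∀ p ∈ P, ∀ q ∈ P, p < q → (∀ z ∈ P, ¬ (p < z ∧ z < q)) → (c p ↔ ¬ c q)) :
    ∀ (n : ℕ), ∀ p ∈ P, ∀ q ∈ P, p < q → (P.filter fun z => p < z ∧ z < q).card = n →
      (Even n ↔ (c p ↔ ¬ c q)) := by
  intro n
  induction n with
  | zero =>
    intro p hp q hq hpq hn
    have h1 := h p hp q hq hpq fun z hz hz' => by
      have := Finset.card_eq_zero.mp hn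
      exact Finset.notMem_empty z (this ▸ Finset.mem_filter.mpr ⟨hz, hz'⟩)
    simp [h1]
  | succ n ih =>
    intro p hp q hq hpq hn
    have hne : (P.filter fun z => p < z ∧ z < q).Nonempty := Finset.card_pos.mp (by omega)
    obtain ⟨y, hy, hmin⟩ := Finset.exists_min_image _ id hne
    obtain ⟨hyP, hpy, hyq⟩ := Finset.mem_filter.mp hy
    have h1 := h p hp y hyP hpy fun z hz hz' =>
      absurd (hmin z (Finset.mem_filter.mpr ⟨hz, hz'.1, hz'.2.trans hyq⟩)) (not_le.mpr hz'.2)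
    have h2 : (P.filter fun z => y < z ∧ z < q) = (P.filter fun z => p < z ∧ z < q).erase y := by
      ext z
      simp only [Finset.mem_filter, Finset.mem_erase]
      constructor
      · rintro ⟨hz, h3, h4⟩
        exact ⟨h3.ne', hz, hpy.trans h3, h4⟩
      · rintro ⟨h3, hz, h4, h5⟩
        exact ⟨hz, lt_of_le_of_ne (hmin z (Finset.mem_filter.mpr ⟨hz, h4, h5⟩)) (Ne.symm h3), h5⟩
    have h3 := ih y hyP q hq hyq (by rw [h2, Finset.card_erase_of_mem hy, hn]; rfl)
    rw [Nat.even_add_one, h3]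
    tauto

variable {K : Placement}

theorem inward_subset : K.inward ⊆ K.coloured := Finset.filter_subset _ _

theorem mem_inward_iff_of_alternating (halt : K.IsAlternating) {m : BPoint → BPoint}
    (hm : IsPartialMatching K.coloured m) {p : BPoint} (hp : p ∈ K.coloured) (hne : m p ≠ p) :
    p ∈ K.inward ↔ m p ∉ K.inward := by
  have key : ∀ p ∈ K.coloured, p < m p → (p ∈ K.inward ↔ m p ∉ K.inward) := fun p hp hlt =>
    (iff_not_of_even_card_between (c := (· ∈ K.inward)) halt _ p hp (m p) (hm.mem p hp) hlt
      rfl).mp (hm.even_card_between hp)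
  rcases lt_or_gt_of_ne hne with h | h
  · have := key (m p) (hm.mem p hp) (by rwa [hm.invol p hp])
    rw [hm.invol p hp] at this
    tauto
  · exact key p hp h

/-- Reversing whole edges of `m` preserves compatibility with `m`, so the orientation `J` produced
by `m` contributes `1`. Any other matching `m'` whose orientation is compatible with `m` yields `J`
again, which is why orientations are counted once. -/
theorem sum_matchFun_reorientations {R : Type*} [CommRing R] (halt : K.IsAlternating)
    {S : Finset BPoint} (hS : S ⊆ K.inward) {m : BPoint → BPoint}
    (hm : IsPartialMatching K.coloured m) (hd : (defects K.coloured m).card = 0) :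
    matchFun R K.coloured m K.inward =
      ∑ I ∈ K.reorientations S, matchFun R K.coloured m I := by
  classical
  have hne : ∀ p ∈ K.coloured, m p ≠ p := fun p hp e => by
    have := Finset.card_eq_zero.mp hd
    exact Finset.notMem_empty p (this ▸ Finset.mem_filter.mpr ⟨hp, e⟩)
  have hin : ∀ p ∈ K.coloured, (p ∈ K.inward ↔ m p ∉ K.inward) := fun p hp =>
    mem_inward_iff_of_alternating halt hm hp (hne p hp)
  have hSP := hS.trans inward_subset
  have hinj : Set.InjOn m S := fun x hx y hy e => by
    rw [← hm.invol x (hSP hx), e, hm.invol y (hSP hy)]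
  have hadm : K.IsAdmissibleMatching m := by
    refine ⟨hm.mem, hm.invol, hin, fun p hp q hq h => ?_⟩
    exact lt_asymm h.2.2 (hm.nested p hp q hq h.1 h.2.1).2.1
  have hcompat : ∀ I ⊆ K.coloured, (∀ p ∈ K.coloured, (p ∈ I ↔ m p ∉ I)) →
      Compatible K.coloured m I := fun I hI h =>
    ⟨hI, fun p hp => (h p hp).mp, fun p hp _ hpI => by
      have := h p hp
      tauto⟩
  set J := symmDiff K.inward (S ∪ S.image m) with hJ
  have hmS : ∀ p ∈ K.coloured, (p ∈ S ∪ S.image m ↔ m p ∈ S ∪ S.image m) := by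
    intro p hp
    simp only [Finset.mem_union, Finset.mem_image]
    constructor
    · rintro (h | ⟨s, hs, rfl⟩)
      · exact Or.inr ⟨p, h, rfl⟩
      · exact Or.inl (by rwa [hm.invol s (hSP hs)])
    · rintro (h | ⟨s, hs, e⟩)
      · exact Or.inr ⟨m p, h, hm.invol p hp⟩
      · have : s = p := by rw [← hm.invol s (hSP hs), e, hm.invol p hp]
        exact Or.inl (this ▸ hs)
  have hJP : J ⊆ K.coloured := by
    intro p hp
    rw [hJ, Finset.mem_symmDiff] at hp
    rcases hp with h | h
    · exact inward_subset h.1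
    · rcases Finset.mem_union.mp h.1 with h | h
      · exact hSP h
      · obtain ⟨s, hs, rfl⟩ := Finset.mem_image.mp h
        exact hm.mem s (hSP hs)
  have hJc : Compatible K.coloured m J := hcompat J hJP fun p hp => by
    have h1 := hin p hp
    have h2 := hmS p hp
    rw [hJ, Finset.mem_symmDiff, Finset.mem_symmDiff]
    tauto
  have hJmem : J ∈ K.reorientations S := Finset.mem_filter.mpr
    ⟨Finset.mem_powerset.mpr hJP, m, hadm, rfl⟩
  rw [Finset.sum_eq_single J]
  · rw [matchFun, matchFun, if_pos hJc, if_pos (hcompat _ inward_subset hin)]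
  · intro I hI hIJ
    obtain ⟨-, m', hm', rfl⟩ := Finset.mem_filter.mp hI
    refine if_neg fun hc => hIJ ?_
    -- A point `s` of `S` is reversed to outward, so compatibility makes `m s` inward. It was
    -- outward before and not in `S`, so it was reversed as a partner under `m'`.
    have hsub : S.image m ⊆ S.image m' := by
      intro q hq
      obtain ⟨s, hs, rfl⟩ := Finset.mem_image.mp hq
      have h1 : s ∉ symmDiff K.inward (S ∪ S.image m') := by
        rw [Finset.mem_symmDiff]
        have := hS hs
        have : s ∈ S ∪ S.image m' := Finset.mem_union_left _ hs
        tauto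
      have h2 := hc.mem s (hSP hs) (hne s (hSP hs)) h1
      have h3 : m s ∉ K.inward := (hin s (hSP hs)).mp (hS hs)
      rw [Finset.mem_symmDiff] at h2
      have h4 : m s ∈ S ∪ S.image m' := by tauto
      exact (Finset.mem_union.mp h4).resolve_left fun h => h3 (hS h)
    have heq := Finset.eq_of_subset_of_card_le hsub (by
      rw [Finset.card_image_of_injOn hinj]; exact Finset.card_image_le)
    rw [hJ, heq]
  · exact fun h => absurd hJmem h

theorem apply_inward_eq_sum_reorientations {R : Type*} [CommRing R] (halt : K.IsAlternating)
    {S : Finset BPoint} (hS : S ⊆ K.inward) {F : Finset BPoint → R}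
    (hF : F ∈ matchSpan R K.coloured 0) : F K.inward = ∑ I ∈ K.reorientations S, F I := by
  induction hF using Submodule.span_induction with
  | mem x h =>
    obtain ⟨m, hm, hd, rfl⟩ := h
    exact sum_matchFun_reorientations halt hS hm hd
  | zero => simp
  | add x y _ _ hx hy => simp only [Pi.add_apply, hx, hy, Finset.sum_add_distrib]
  | smul c x _ hx => simp only [Pi.smul_apply, hx, Finset.smul_sum]

/-- The identity of generating functions for an alternating placement. -/
theorem orientationAmplitude_inward (halt : K.IsAlternating) {S : Finset BPoint}
    (hS : S ⊆ K.inward) (N : ℕ) (a b : ℤ) :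
    orientationAmplitude K N a b K.inward =
      ∑ I ∈ K.reorientations S, orientationAmplitude K N a b I := by
  classical
  -- The function is cut off outside the subsets of the coloured points, since membership in the
  -- span constrains it on all finite sets.
  have hmem : (fun I => if I ⊆ K.coloured then orientationAmplitude K N a b I else 0) ∈
      matchSpan (MvPolynomial (Fin N) ℤ) K.coloured 0 := by
    refine mem_matchSpan _ 0 _ (fun I hI => ?_) (fun I hI => ?_)
    · by_cases h : I ⊆ K.coloured
      · rw [if_pos h] at hI
        exact ⟨h, card_coloured_of_orientationAmplitude_ne_zero h hI⟩
      · exact absurd (if_neg h) hI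
    · rw [raising_congr (G := orientationAmplitude K N a b) (fun J hJ => if_pos hJ) hI]
      exact raising_orientationAmplitude hI
  have h := apply_inward_eq_sum_reorientations halt hS hmem
  rw [if_pos inward_subset] at h
  rw [h]
  refine Finset.sum_congr rfl fun I hI => if_pos ?_
  exact Finset.mem_powerset.mp (Finset.mem_filter.mp hI).1

theorem mem_coloured {p : BPoint} : p ∈ K.coloured ↔
    p ∈ K.white ∧ p ∉ K.black ∨ p ∈ K.black ∧ p ∉ K.white := Finset.mem_symmDiff

theorem mem_reorient_white {I : Finset BPoint} {p : BPoint} : p ∈ (K.reorient I).white ↔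
    p ∈ K.white ∧ p ∈ K.black ∨ p ∈ K.coloured ∧ (p ∈ I ↔ IsEnd p) := by
  simp [Placement.reorient]

theorem mem_reorient_black {I : Finset BPoint} {p : BPoint} : p ∈ (K.reorient I).black ↔
    p ∈ K.white ∧ p ∈ K.black ∨ p ∈ K.coloured ∧ ¬ (p ∈ I ↔ IsEnd p) := by
  simp only [Placement.reorient, Finset.mem_union, Finset.mem_inter, Finset.mem_filter]

theorem mem_inward {p : BPoint} :
    p ∈ K.inward ↔ p ∈ K.coloured ∧ (p ∈ K.white ↔ IsEnd p) := Finset.mem_filter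

theorem reorient_inward_white : (K.reorient K.inward).white = K.white := by
  ext p
  rw [mem_reorient_white, mem_inward, mem_coloured]
  tauto

theorem reorient_inward_black : (K.reorient K.inward).black = K.black := by
  ext p
  rw [mem_reorient_black, mem_inward, mem_coloured]
  tauto

theorem reorient_white_subset (I : Finset BPoint) :
    (K.reorient I).white ⊆ K.white ∪ K.black := by
  intro p
  simp only [Placement.reorient, Placement.coloured, Finset.mem_union, Finset.mem_inter,
    Finset.mem_filter, Finset.mem_symmDiff]
  tauto

theorem reorient_black_subset (I : Finset BPoint) :
    (K.reorient I).black ⊆ K.white ∪ K.black := by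
  intro p
  simp only [Placement.reorient, Placement.coloured, Finset.mem_union, Finset.mem_inter,
    Finset.mem_filter, Finset.mem_symmDiff]
  tauto

theorem startXs_shapePoints (lam mu : YoungDiagram) (t : ℤ) :
    startXs (shapePoints lam mu t) = rowPoints (lam.colLen 0) mu t := by
  ext x
  simp only [mem_startXs, shapePoints, mem_rowPoints, Finset.mem_union, Finset.mem_image,
    Finset.mem_range, endPt_ne_startPt, and_false, exists_false, false_or,
    startPt_injective.eq_iff, rowPoint]

theorem endXs_shapePoints (lam mu : YoungDiagram) (t : ℤ) :
    endXs (shapePoints lam mu t) = rowPoints (lam.colLen 0) lam t := by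
  ext x
  simp only [mem_endXs, shapePoints, mem_rowPoints, Finset.mem_union, Finset.mem_image,
    Finset.mem_range, (endPt_ne_startPt _ _).symm, and_false, exists_false, or_false,
    endPt_injective.eq_iff, rowPoint]

theorem rowLen_colLen_zero (lam : YoungDiagram) : lam.rowLen (lam.colLen 0) = 0 := by
  by_contra h
  have h1 : (lam.colLen 0, 0) ∈ lam := YoungDiagram.mem_iff_lt_rowLen.mpr (Nat.pos_of_ne_zero h)
  exact lt_irrefl _ (YoungDiagram.mem_iff_lt_colLen.mp h1)

theorem skewSchur_eq_schurAmplitude_shapePoints {N : ℕ} {lam mu : YoungDiagram} (hle : mu ≤ lam)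
    {t a b : ℤ} (ha : ∀ x ∈ startXs (shapePoints lam mu t), a ≤ x)
    (hb : ∀ x ∈ endXs (shapePoints lam mu t), x ≤ b) :
    skewSchur N lam mu = schurAmplitude N a b (startXs (shapePoints lam mu t))
      (endXs (shapePoints lam mu t)) := by
  rw [startXs_shapePoints] at ha ⊢
  rw [endXs_shapePoints] at hb ⊢
  exact skewSchur_eq_schurAmplitude hle (rowLen_colLen_zero lam) ha hb

end Counting

end BicolouredPaths

/-! ### The identity for skew Schur functions. -/

theorem mainTheorem1 (N : ℕ) (lam mu sig tau : YoungDiagram) (hmu : mu ≤ lam) (htau : tau ≤ sig)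
    (t : ℤ)
    (halt : (BicolouredPaths.Placement.ofShapes lam mu sig tau t).IsAlternating)
    (S : Finset BicolouredPaths.BPoint)
    (hS : S ⊆ (BicolouredPaths.Placement.ofShapes lam mu sig tau t).inward) :
    BicolouredPaths.skewSchur N lam mu * BicolouredPaths.skewSchur N sig tau =
      ∑ I ∈ (BicolouredPaths.Placement.ofShapes lam mu sig tau t).reorientations S,
        BicolouredPaths.pointsSchur N
            ((BicolouredPaths.Placement.ofShapes lam mu sig tau t).reorient I).white *
          BicolouredPaths.pointsSchur N
            ((BicolouredPaths.Placement.ofShapes lam mu sig tau t).reorient I).black := by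
  open BicolouredPaths in
  set K := Placement.ofShapes lam mu sig tau t with hK
  -- Reorientation introduces no new points, so one window `[a, b]` serves all orientations.
  obtain ⟨a, ha⟩ := (startXs (K.white ∪ K.black)).bddBelow
  obtain ⟨b, hb⟩ := (endXs (K.white ∪ K.black)).bddAbove
  have ha' : ∀ F ⊆ K.white ∪ K.black, ∀ x ∈ startXs F, a ≤ x := fun F hF x hx =>
    ha (mem_startXs.mpr (hF (mem_startXs.mp hx)))
  have hb' : ∀ F ⊆ K.white ∪ K.black, ∀ x ∈ endXs F, x ≤ b := fun F hF x hx =>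
    hb (mem_endXs.mpr (hF (mem_endXs.mp hx)))
  have h1 : skewSchur N lam mu * skewSchur N sig tau = orientationAmplitude K N a b K.inward := by
    unfold orientationAmplitude
    rw [reorient_inward_white, reorient_inward_black]
    congr 1
    · exact skewSchur_eq_schurAmplitude_shapePoints hmu (ha' _ Finset.subset_union_left)
        (hb' _ Finset.subset_union_left)
    · exact skewSchur_eq_schurAmplitude_shapePoints htau (ha' _ Finset.subset_union_right)
        (hb' _ Finset.subset_union_right)
  rw [h1, orientationAmplitude_inward halt hS]
  refine Finset.sum_congr rfl fun I _ => ?_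
  rw [pointsSchur_eq_schurAmplitude N (ha' _ (reorient_white_subset I))
      (hb' _ (reorient_white_subset I)),
    pointsSchur_eq_schurAmplitude N (ha' _ (reorient_black_subset I))
      (hb' _ (reorient_black_subset I))]
  rfl
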